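/- Fix a von Neumann algebra $N$ and a universe of Hilbert spaces. "Normal" means ultraweakly continuous, $S'$ denotes the commutant of $S$ and $[\,\cdot\,]$ the closed linear span. **Bimodules.** An $N$-bimodule is a triple $(H,\rho,\sigma)$ of a Hilbert space $H$, a faithful normal unital representation $\rho$ of $N$ and a faithful normal unital representation $\sigma$ of $N^{op}$ on $H$ such that $\rho(N)$ and $\sigma(N^{op})$ commute. Morphisms are the bounded operators that intertwine both actions. **The 2-category $\mathbf{W^*}_{(N,N^{op})}$.** Its objects are von Neumann algebras $A\subseteq\mathcal L(H)$ with injective normal unital $*$-homomorphisms $\iota_A\colon N\to A$ and $\iota_A^{op}\colon N^{op}\to A$ whose images commute. Its morphisms are the normal unital $*$-homomorphisms $\phi\colon A\to B$ with $\phi\iota_A=\iota_B$ and $\phi\iota^{op}_A=\iota_B^{op}$. Its 2-cells $\phi\Rightarrow\psi$ are the $b\in B$ with $b\phi(a)=\psi(a)b$ for all $a\in A$. Vertical composition is multiplication, and the horizontal composite of $b\colon\phi_1\Rightarrow\phi_2$ $(A\to B)$ with $c\colon\psi_1\Rightarrow\psi_2$ $(B\to C)$ is $\psi_2(b)c$.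 **The 2-category $\mathbf{Cat}_{(N,N^{op})}$.** Its objects are categories $\mathbf C$ with a functor $\mathbf U_{\mathbf C}$ to $N$-bimodules such that for every $f\colon X\to Y$ in $\mathbf C$ the adjoint operator $\mathbf U_{\mathbf C}(f)^*$ equals $\mathbf U_{\mathbf C}(g)$ for some $g\colon Y\to X$, and such that there is a separating object. Here, with $\mathbf H_{\mathbf C}$ the underlying functor to Hilbert spaces, $G\in\mathbf C$ is separating if $[\mathbf H_{\mathbf C}(\mathbf C(G,X))\,\mathbf H_{\mathbf C}G]=\mathbf H_{\mathbf C}X$ for all $X$. Morphisms are the functors $\mathbf F\colon\mathbf C\to\mathbf D$ with $\mathbf U_{\mathbf D}\mathbf F=\mathbf U_{\mathbf C}$, and 2-cells are all natural transformations, with the usual compositions. **$\mathbf{Mod}$.** For $A\in\mathbf{W^*}_{(N,N^{op})}$, $\mathbf{Mod}(A)$ is the category of normal unital representations $(L,\pi)$ of $A$ for which $\pi\iota_A$ and $\pi\iota_A^{op}$ are faithful, with all bounded intertwiners, over $N$-bimodules by $(L,\pi)\mapsto(L,\pi\iota_A,\pi\iota_A^{op})$, $T\mapsto T$. For $\phi\colon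 A\to B$, $\mathbf{Mod}(\phi)\colon\mathbf{Mod}(B)\to\mathbf{Mod}(A)$ is $(L,\pi)\mapsto(L,\pi\phi)$, $T\mapsto T$. For a 2-cell $b$, $\mathbf{Mod}(b)=(\pi(b))_{(L,\pi)}$. **$\mathbf{End}$.** Choose, in any way, a separating object $G_{\mathbf C}$ for every $\mathbf C\in\mathbf{Cat}_{(N,N^{op})}$. Put $\mathbf{End}(\mathbf C):=\mathbf H_{\mathbf C}(\mathbf C(G_{\mathbf C},G_{\mathbf C}))'\subseteq\mathcal L(\mathbf H_{\mathbf C}G_{\mathbf C})$, with the (anti-)embeddings of $N$ given by $\mathbf U_{\mathbf C}G_{\mathbf C}$. For $X\in\mathbf C$ let $\rho^X\colon\mathbf{End}(\mathbf C)\to\mathcal L(\mathbf H_{\mathbf C}X)$ be the normal unital representation determined by $\rho^X(a)\,\mathbf H_{\mathbf C}(f)=\mathbf H_{\mathbf C}(f)\,a$ for all $f\in\mathbf C(G_{\mathbf C},X)$. For $\mathbf F\colon\mathbf C\to\mathbf D$ let $\mathbf{End}(\mathbf F):=\rho^{\mathbf FG_{\mathbf C}}\colon\mathbf{End}(\mathbf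 D)\to\mathbf{End}(\mathbf C)$, and for $\alpha\colon\mathbf F\Rightarrow\mathbf F'$ let $\mathbf{End}(\alpha):=\mathbf H_{\mathbf D}(\alpha_{G_{\mathbf C}})$. **The maps.** For $\mathbf C\in\mathbf{Cat}_{(N,N^{op})}$ and $A\in\mathbf{W^*}_{(N,N^{op})}$, let $$\Phi_{\mathbf C,A}\colon\mathbf{Cat}_{(N,N^{op})}(\mathbf C,\mathbf{Mod}(A))\to\mathbf{W^*}_{(N,N^{op})}(A,\mathbf{End}(\mathbf C))$$ be given by $\mathbf FG_{\mathbf C}=(\mathbf H_{\mathbf C}G_{\mathbf C},\Phi_{\mathbf C,A}(\mathbf F))$ on functors and $\alpha\mapsto\alpha_{G_{\mathbf C}}$ on natural transformations. Let $\eta_{\mathbf C}\colon\mathbf C\to\mathbf{Mod}(\mathbf{End}(\mathbf C))$ be $X\mapsto(\mathbf H_{\mathbf C}X,\rho^X)$, $T\mapsto\mathbf H_{\mathbf C}T$. Let $\Psi_{\mathbf C,A}$ be given by $\pi\mapsto\mathbf{Mod}(\pi)\circ\eta_{\mathbf C}$ on morphisms and $S\mapsto(\rho^X(S))_{X\in\mathbf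 C}$ on 2-cells. Let $\epsilon_A:=\rho^{\mathrm{Id}_A}\colon\mathbf{End}(\mathbf{Mod}(A))\to A$, where $\mathrm{Id}_A\in\mathbf{Mod}(A)$ is the identity representation of $A\subseteq\mathcal L(H)$. **Theorem.** 1. $\mathbf{Mod}$ is a contravariant (strict) functor of 2-categories $\mathbf{W^*}_{(N,N^{op})}\to\mathbf{Cat}_{(N,N^{op})}$, and $\mathbf{End}$ is a contravariant (strict) functor of 2-categories $\mathbf{Cat}_{(N,N^{op})}\to\mathbf{W^*}_{(N,N^{op})}$ (both reverse morphisms and preserve the direction of 2-cells). 2. $(\Phi_{\mathbf C,A})_{\mathbf C,A}$ is an adjunction between $\mathbf{Mod}$ and $\mathbf{End}$: each $\Phi_{\mathbf C,A}$ is an isomorphism of categories with inverse $\Psi_{\mathbf C,A}$, and it is natural with respect to morphisms and 2-cells in both variables; on morphisms, $$\Phi_{\mathbf C,A}(\mathbf{Mod}(\phi)\circ\mathbf X\circ\mathbf F)=\mathbf{End}(\mathbf F)\circ\Phi_{\mathbf D,B}(\mathbf X)\circ\phi\qquad(\mathbf F\colon\mathbf C\to\mathbf D,\ \mathbf X\colon\mathbf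 D\to\mathbf{Mod}(B),\ \phi\colon A\to B),$$ and the corresponding identity holds for horizontal composites of 2-cells. 3. Its unit is $(\eta_{\mathbf C})_{\mathbf C}$, that is, $\Phi_{\mathbf C,\mathbf{End}(\mathbf C)}(\eta_{\mathbf C})=\mathrm{id}$, and its counit is given by $(\epsilon_A)_A$, that is, $\epsilon_A$ is an isomorphism in $\mathbf{W^*}_{(N,N^{op})}$ with inverse $\Phi_{\mathbf{Mod}(A),A}(\mathrm{id}_{\mathbf{Mod}(A)})\colon A\to\mathbf{End}(\mathbf{Mod}(A))$. The triangle identities $\mathbf{Mod}(\epsilon_A^{-1})\circ\eta_{\mathbf{Mod}(A)}=\mathrm{id}$ and $\mathbf{End}(\eta_{\mathbf C})\circ\epsilon_{\mathbf{End}(\mathbf C)}^{-1}=\mathrm{id}$ hold. -/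

import Mathlib

open CategoryTheory MulOpposite
open scoped InnerProductSpace

universe u

set_option linter.unusedSectionVars false

namespace VNCat

section Analysis

variable {H K : Type u} [NormedAddCommGroup H] [InnerProductSpace ℂ H] [CompleteSpace H]
  [NormedAddCommGroup K] [InnerProductSpace ℂ K] [CompleteSpace K]

theorem summable_inner_of_sq {ι : Type*} {x y : ι → H} (hx : Summable fun i => ‖x i‖ ^ 2)
    (hy : Summable fun i => ‖y i‖ ^ 2) (a : H →L[ℂ] H) : Summable fun i => ⟪x i, a (y i)⟫_ℂ := by
  refine Summable.of_norm_bounded (g := fun i => ‖a‖ * (‖x i‖ ^ 2 + ‖y i‖ ^ 2))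
    ((hx.add hy).mul_left _) fun i => ?_
  have h1 := norm_inner_le_norm (𝕜 := ℂ) (x i) (a (y i))
  have h2 := a.le_opNorm (y i)
  nlinarith [mul_le_mul_of_nonneg_left h2 (norm_nonneg (x i)), norm_nonneg a,
    mul_nonneg (norm_nonneg a) (sq_nonneg (‖x i‖ - ‖y i‖)), norm_nonneg (x i), norm_nonneg (y i),
    mul_nonneg (norm_nonneg a) (sq_nonneg (‖x i‖)), mul_nonneg (norm_nonneg a) (sq_nonneg (‖y i‖))]

/-- Quantitative form of ultraweak continuity on a set `S` of operators. -/
def Rep (S : Set (H →L[ℂ] H)) (f : (H →L[ℂ] H) → ℂ) (α β : ℝ) : Prop :=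
  ∃ u v : ℕ → H, Summable (fun n => ‖u n‖ ^ 2) ∧ ∑' n, ‖u n‖ ^ 2 ≤ α ∧
    Summable (fun n => ‖v n‖ ^ 2) ∧ ∑' n, ‖v n‖ ^ 2 ≤ β ∧
    ∀ a ∈ S, f a = ∑' n, ⟪u n, a (v n)⟫_ℂ

theorem Rep.of_countable {S : Set (H →L[ℂ] H)} {f : (H →L[ℂ] H) → ℂ} {α β : ℝ}
    {ι : Type*} [Countable ι] (u v : ι → H) (hu : Summable (fun n => ‖u n‖ ^ 2))
    (hα : ∑' n, ‖u n‖ ^ 2 ≤ α) (hv : Summable (fun n => ‖v n‖ ^ 2)) (hβ : ∑' n, ‖v n‖ ^ 2 ≤ β)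
    (hf : ∀ a ∈ S, f a = ∑' n, ⟪u n, a (v n)⟫_ℂ) : Rep S f α β := by
  obtain ⟨e, he⟩ := exists_injective_nat ι
  have key : ∀ w : ι → H, (fun n => ‖Function.extend e w 0 n‖ ^ 2)
      = Function.extend e (fun i => ‖w i‖ ^ 2) 0 := by
    intro w; ext n
    by_cases h : ∃ i, e i = n
    · obtain ⟨i, rfl⟩ := h
      simp [he.extend_apply]
    · simp [Function.extend_apply' _ _ _ h]
  refine ⟨Function.extend e u 0, Function.extend e v 0, ?_, ?_, ?_, ?_, ?_⟩
  · rw [key]; exact ((hasSum_extend_zero he).2 hu.hasSum).summable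
  · rw [key, ((hasSum_extend_zero he).2 hu.hasSum).tsum_eq]; exact hα
  · rw [key]; exact ((hasSum_extend_zero he).2 hv.hasSum).summable
  · rw [key, ((hasSum_extend_zero he).2 hv.hasSum).tsum_eq]; exact hβ
  · intro a ha
    have : (fun n => ⟪Function.extend e u 0 n, a (Function.extend e v 0 n)⟫_ℂ)
        = Function.extend e (fun i => ⟪u i, a (v i)⟫_ℂ) 0 := by
      ext n
      by_cases h : ∃ i, e i = n
      · obtain ⟨i, rfl⟩ := h
        simp [he.extend_apply]
      · simp [Function.extend_apply' _ _ _ h]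
    rw [this, ((hasSum_extend_zero he).2 (summable_inner_of_sq hu hv a).hasSum).tsum_eq, hf a ha]

theorem Rep.congr {S : Set (H →L[ℂ] H)} {f g : (H →L[ℂ] H) → ℂ} {α β : ℝ} (h : Rep S f α β)
    (hfg : ∀ a ∈ S, g a = f a) : Rep S g α β := by
  obtain ⟨u, v, h1, h2, h3, h4, h5⟩ := h
  exact ⟨u, v, h1, h2, h3, h4, fun a ha => (hfg a ha).trans (h5 a ha)⟩

theorem Rep.mono {S : Set (H →L[ℂ] H)} {f : (H →L[ℂ] H) → ℂ} {α β α' β' : ℝ} (h : Rep S f α β)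
    (hα : α ≤ α') (hβ : β ≤ β') : Rep S f α' β' := by
  obtain ⟨u, v, h1, h2, h3, h4, h5⟩ := h
  exact ⟨u, v, h1, h2.trans hα, h3, h4.trans hβ, h5⟩

theorem Rep.smul {S : Set (H →L[ℂ] H)} {f : (H →L[ℂ] H) → ℂ} {α β : ℝ} (h : Rep S f α β)
    (s t : ℝ) : Rep S (fun a => (s * t : ℝ) * f a) (s ^ 2 * α) (t ^ 2 * β) := by
  obtain ⟨u, v, h1, h2, h3, h4, h5⟩ := h
  refine ⟨fun n => (s : ℂ) • u n, fun n => (t : ℂ) • v n, ?_, ?_, ?_, ?_, ?_⟩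
  · simpa [norm_smul, mul_pow] using h1.mul_left (s ^ 2)
  · simp only [norm_smul, mul_pow, tsum_mul_left, Complex.norm_real, Real.norm_eq_abs, sq_abs]
    exact mul_le_mul_of_nonneg_left h2 (sq_nonneg _)
  · simpa [norm_smul, mul_pow] using h3.mul_left (t ^ 2)
  · simp only [norm_smul, mul_pow, tsum_mul_left, Complex.norm_real, Real.norm_eq_abs, sq_abs]
    exact mul_le_mul_of_nonneg_left h4 (sq_nonneg _)
  · intro a ha
    simp only [map_smul, inner_smul_left, inner_smul_right, Complex.conj_ofReal, h5 a ha]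
    rw [← tsum_mul_left]
    refine tsum_congr fun n => ?_
    push_cast; ring

theorem Rep.tsum {S : Set (H →L[ℂ] H)} {f : ℕ → (H →L[ℂ] H) → ℂ} {α β : ℕ → ℝ}
    (h : ∀ k, Rep S (f k) (α k) (β k)) (hα : Summable α) (hβ : Summable β) :
    Rep S (fun a => ∑' k, f k a) (∑' k, α k) (∑' k, β k) := by
  choose u v h1 h2 h3 h4 h5 using h
  have aux : ∀ (w : ℕ → ℕ → H) (γ : ℕ → ℝ), Summable γ → (∀ k, Summable fun n => ‖w k n‖ ^ 2) →
      (∀ k, ∑' n, ‖w k n‖ ^ 2 ≤ γ k) → Summable (fun p : ℕ × ℕ => ‖w p.1 p.2‖ ^ 2) ∧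
        ∑' p : ℕ × ℕ, ‖w p.1 p.2‖ ^ 2 ≤ ∑' k, γ k := by
    intro w γ hγ hw hle
    have hs : Summable (fun k => ∑' n, ‖w k n‖ ^ 2) :=
      Summable.of_nonneg_of_le (fun k => tsum_nonneg fun n => sq_nonneg _) hle hγ
    have hs2 : Summable (fun p : ℕ × ℕ => ‖w p.1 p.2‖ ^ 2) :=
      (summable_prod_of_nonneg (fun p => sq_nonneg _)).2 ⟨hw, hs⟩
    refine ⟨hs2, ?_⟩
    rw [hs2.tsum_prod]
    exact hs.tsum_le_tsum hle hγ
  obtain ⟨hu, hu'⟩ := aux u α hα h1 h2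
  obtain ⟨hv, hv'⟩ := aux v β hβ h3 h4
  refine Rep.of_countable (fun p : ℕ × ℕ => u p.1 p.2) (fun p : ℕ × ℕ => v p.1 p.2) hu hu' hv hv' ?_
  intro a ha
  have hs := summable_inner_of_sq hu hv a
  rw [hs.tsum_prod]
  exact tsum_congr fun k => h5 k a ha

/-- The diagonal action of an operator on a Hilbert sum of copies of `H`. -/
noncomputable def diag (ι : Type*) (a : H →L[ℂ] H) :
    lp (fun _ : ι => H) 2 →L[ℂ] lp (fun _ : ι => H) 2 :=
  LinearMap.mkContinuous
    { toFun := fun x => ⟨fun i => a (x i), by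
        have hx : Memℓp (fun i => x i) 2 := lp.memℓp x
        refine memℓp_gen ?_
        have h2 : Summable fun i => ‖x i‖ ^ (2 : ENNReal).toReal := hx.summable (by norm_num)
        refine Summable.of_nonneg_of_le (fun i => by positivity) (fun i => ?_)
          (h2.mul_left (‖a‖ ^ (2 : ENNReal).toReal))
        rw [← Real.mul_rpow (norm_nonneg _) (norm_nonneg _)]
        exact Real.rpow_le_rpow (norm_nonneg _) (a.le_opNorm _) (by norm_num)⟩
      map_add' := fun x y => by ext i; exact map_add a (x i) (y i)
      map_smul' := fun c x => by ext i; exact map_smul a c (x i) } ‖a‖ (by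
    intro x
    refine lp.norm_le_of_forall_sum_le (by norm_num) (by positivity) ?_
    intro s
    have h := lp.sum_rpow_le_norm_rpow (p := 2) (by norm_num) x s
    rw [Real.mul_rpow (norm_nonneg _) (norm_nonneg _)]
    refine le_trans ?_ (mul_le_mul_of_nonneg_left h (by positivity))
    rw [Finset.mul_sum]
    refine Finset.sum_le_sum fun i _ => ?_
    rw [← Real.mul_rpow (norm_nonneg _) (norm_nonneg _)]
    exact Real.rpow_le_rpow (norm_nonneg _) (a.le_opNorm _) (by norm_num))

@[simp] theorem diag_apply (ι : Type*) (a : H →L[ℂ] H) (x : lp (fun _ : ι => H) 2) (i : ι) :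
    diag ι a x i = a (x i) := rfl

open ContinuousLinearMap in
theorem diag_adjoint_inner (ι : Type*) (a : H →L[ℂ] H) (x y : lp (fun _ : ι => H) 2) :
    ⟪diag ι a x, y⟫_ℂ = ⟪x, diag ι (adjoint a) y⟫_ℂ := by
  rw [lp.inner_eq_tsum, lp.inner_eq_tsum]
  exact tsum_congr fun i => by simp [adjoint_inner_right]

open ContinuousLinearMap in
theorem exists_sqrt {E K : Type*} [NormedAddCommGroup E] [InnerProductSpace ℂ E] [CompleteSpace E]
    [NormedAddCommGroup K] [InnerProductSpace ℂ K] [CompleteSpace K] (P : E →L[ℂ] E)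
    (hP : P.IsPositive) : ∃ b : E →L[ℂ] E, adjoint b = b ∧ b * b = P ∧
      ∀ D : E →L[ℂ] E, D * P = P * D → D * b = b * D := by
  have hPnn : 0 ≤ P := (nonneg_iff_isPositive P).2 hP
  refine ⟨CFC.sqrt P, (IsSelfAdjoint.of_nonneg (CFC.sqrt_nonneg P)).star_eq,
    CFC.sqrt_mul_sqrt_self P hPnn, fun D hD => ?_⟩
  have h : Commute P D := hD.symm
  exact (h.cfcₙ_nnreal NNReal.sqrt).symm

open ContinuousLinearMap in
theorem exists_regularized {E K : Type*} [NormedAddCommGroup E] [InnerProductSpace ℂ E]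
    [CompleteSpace E] [NormedAddCommGroup K] [InnerProductSpace ℂ K] [CompleteSpace K]
    (R : E →L[ℂ] K) {δ : ℝ} (hδ : 0 < δ) : ∃ b c : E →L[ℂ] E, c * b = 1 ∧
      (∀ w, ‖b w‖ ^ 2 = ‖R w‖ ^ 2 + δ * ‖w‖ ^ 2) ∧ (∀ x, ‖adjoint c (adjoint R x)‖ ≤ ‖x‖) ∧
      ∀ D : E →L[ℂ] E, D * (adjoint R ∘L R) = (adjoint R ∘L R) * D → D * c = c * D := by
  let P : E →L[ℂ] E := adjoint R ∘L R + (δ : ℂ) • (1 : E →L[ℂ] E)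
  have hPos : ((δ : ℂ) • (1 : E →L[ℂ] E)).IsPositive := by
    refine (isPositive_one (𝕜 := ℂ) (E := E)).smul_of_nonneg ?_
    exact_mod_cast hδ.le
  have hP : P.IsPositive := (isPositive_adjoint_comp_self R).add hPos
  obtain ⟨b, hbsa, hbb, hbc⟩ := exists_sqrt (K := K) P hP
  have hbn : ∀ w, ‖b w‖ ^ 2 = ‖R w‖ ^ 2 + δ * ‖w‖ ^ 2 := by
    intro w
    have h1 : ⟪b w, b w⟫_ℂ = ⟪w, P w⟫_ℂ := by
      rw [← adjoint_inner_right, hbsa, ← hbb]; rfl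
    have h2 : ⟪w, P w⟫_ℂ = ⟪R w, R w⟫_ℂ + δ * ⟪w, w⟫_ℂ := by
      simp [P, adjoint_inner_right]
    rw [h2] at h1
    simp only [inner_self_eq_norm_sq_to_K] at h1
    have h3 := congrArg Complex.re h1
    simpa [← Complex.ofReal_pow] using h3
  have hu : IsUnit b := by
    have hPu : IsUnit P := by
      refine isUnit_of_forall_le_norm_inner_map P (c := ⟨δ, hδ.le⟩) (by exact_mod_cast hδ) fun x => ?_
      have h1 : ⟪P x, x⟫_ℂ = ((‖b x‖ ^ 2 : ℝ) : ℂ) := by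
        rw [← hbb]
        change ⟪b (b x), x⟫_ℂ = _
        rw [← adjoint_inner_right, hbsa, inner_self_eq_norm_sq_to_K]
        simp
      rw [h1, Complex.norm_real, Real.norm_eq_abs, abs_of_nonneg (sq_nonneg _), hbn]
      change ‖x‖ ^ 2 * δ ≤ _
      nlinarith [sq_nonneg ‖R x‖]
    rw [← hbb] at hPu
    exact isUnit_mul_self_iff.1 hPu
  obtain ⟨c, hcb, hbc'⟩ : ∃ c, c * b = 1 ∧ b * c = 1 := by
    obtain ⟨U, rfl⟩ := hu
    exact ⟨↑U⁻¹, by simp, by simp⟩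
  have hcsa : adjoint c = c := by
    have h := congrArg adjoint hcb
    have h' : b * adjoint c = 1 := by
      have : star (c * b) = 1 := by rw [hcb, star_one]
      rw [star_mul] at this
      have hb' : star b = b := hbsa
      rw [hb'] at this
      exact this
    calc adjoint c = (c * b) * adjoint c := by rw [hcb, one_mul]
      _ = c * (b * adjoint c) := by rw [mul_assoc]
      _ = c := by rw [h', mul_one]
  refine ⟨b, c, hcb, hbn, fun x => ?_, fun D hD => ?_⟩
  · set y := adjoint R x
    rw [hcsa]
    have h1 : ‖R (c (c y))‖ ≤ ‖c y‖ := by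
      have h2 := hbn (c (c y))
      have h3 : b (c (c y)) = c y := by
        change (b * c) (c y) = _
        rw [hbc']; rfl
      rw [h3] at h2
      refine le_of_sq_le_sq ?_ (norm_nonneg _) 
      nlinarith [mul_nonneg hδ.le (sq_nonneg ‖c (c y)‖)]
    have h2 : ‖c y‖ ^ 2 ≤ ‖c y‖ * ‖x‖ := by
      have h3 : ⟪c y, c y⟫_ℂ = ⟪R (c (c y)), x⟫_ℂ := by
        rw [← adjoint_inner_right R, ← adjoint_inner_left c, hcsa]
      have h4 : ‖⟪c y, c y⟫_ℂ‖ = ‖c y‖ ^ 2 := by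
        rw [inner_self_eq_norm_sq_to_K]; simp
      rw [← h4, h3]
      exact (norm_inner_le_norm _ _).trans (mul_le_mul_of_nonneg_right h1 (norm_nonneg _))
    by_contra hcon
    push Not at hcon
    nlinarith [norm_nonneg x]
  · have h := hbc D (by
      simp only [P, mul_add, add_mul, hD]
      congr 1
      ext w; simp)
    calc D * c = (c * b) * (D * c) := by rw [hcb, one_mul]
      _ = c * (b * D) * c := by simp only [mul_assoc]
      _ = c * (D * b) * c := by rw [h]
      _ = c * D * (b * c) := by simp only [mul_assoc]
      _ = c * D := by rw [hbc', mul_one]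

open ContinuousLinearMap in
theorem rep_of_finite {S : Set (H →L[ℂ] H)} {ι : Type} [Fintype ι] (T : ι → H →L[ℂ] K)
    (hT : ∀ a ∈ S, ∀ i j, a * (adjoint (T i) ∘L T j) = (adjoint (T i) ∘L T j) * a)
    (ζ : ι → H) (x : K) {ε : ℝ} (hε : 0 < ε) :
    Rep S (fun a => ⟪x, ∑ i, T i (a (ζ i))⟫_ℂ) (‖x‖ ^ 2) (‖∑ i, T i (ζ i)‖ ^ 2 + ε) := by
  let R : lp (fun _ : ι => H) 2 →L[ℂ] K := ∑ i, T i ∘L lp.evalCLM ℂ (fun _ : ι => H) 2 i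
  have hR : ∀ v : lp (fun _ : ι => H) 2, R v = ∑ i, T i (v i) := fun v => by
    simp only [R, _root_.sum_apply]
    rfl
  have hRad : ∀ (k : K) (i : ι), adjoint R k i = adjoint (T i) k := by
    classical
    intro k i
    refine ext_inner_left ℂ fun h => ?_
    have h1 := lp.inner_single_left (𝕜 := ℂ) i h (adjoint R k)
    rw [← h1, adjoint_inner_right, adjoint_inner_right, hR]
    congr 1
    rw [Finset.sum_eq_single i]
    · simp
    · intro j _ hj
      simp [hj]
    · simp
  let z : lp (fun _ : ι => H) 2 := ⟨ζ, Memℓp.all _⟩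
  have hz : ∀ i, z i = ζ i := fun i => rfl
  obtain ⟨δ, hδ, hδε⟩ : ∃ δ : ℝ, 0 < δ ∧ δ * ‖z‖ ^ 2 ≤ ε := by
    refine ⟨ε / (‖z‖ ^ 2 + 1), by positivity, ?_⟩
    rw [div_mul_eq_mul_div, div_le_iff₀ (by positivity)]
    nlinarith
  obtain ⟨b, c, hcb, hbn, hcR, hcD⟩ := exists_regularized R hδ
  have hsum : ∀ w : lp (fun _ : ι => H) 2, ∑' i, ‖w i‖ ^ 2 = ‖w‖ ^ 2 := fun w => by
    have := lp.norm_rpow_eq_tsum (p := 2) (by norm_num) w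
    simp only [ENNReal.toReal_ofNat, Real.rpow_ofNat] at this
    exact this.symm
  refine Rep.of_countable (fun i => adjoint c (adjoint R x) i) (fun i => b z i)
    (hasSum_fintype _).summable ?_ (hasSum_fintype _).summable ?_ ?_
  · rw [hsum]
    have := hcR x
    gcongr
  · rw [hsum, hbn, hR]
    simp only [hz]
    linarith
  · intro a ha
    have hD : diag ι a * (adjoint R ∘L R) = (adjoint R ∘L R) * diag ι a := by
      ext v i
      change a (adjoint R (R v) i) = adjoint R (R (diag ι a v)) i
      rw [hRad, hRad, hR, hR, map_sum, map_sum, map_sum]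
      refine Finset.sum_congr rfl fun j _ => ?_
      exact congrArg (fun f : H →L[ℂ] H => f (v j)) (hT a ha i j)
    have h1 : ∑ i, T i (a (ζ i)) = R (diag ι a z) := by rw [hR]; rfl
    have h2 : diag ι a z = c (diag ι a (b z)) := by
      have := congrArg (fun f : lp (fun _ : ι => H) 2 →L[ℂ] lp (fun _ : ι => H) 2 => f (b z))
        (hcD _ hD)
      change diag ι a (c (b z)) = c (diag ι a (b z)) at this
      rw [← this]
      change _ = diag ι a ((c * b) z)
      rw [hcb]; rfl
    rw [h1, h2, ← adjoint_inner_left, ← adjoint_inner_left, lp.inner_eq_tsum]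
    rfl

open ContinuousLinearMap in
/-- If `r` is implemented on the span of the ranges of the intertwiners in `I`, then every vector
functional composed with `r` is ultraweakly continuous, with norm control. -/
theorem rep_of_unit {S : Set (H →L[ℂ] H)} {I : Set (H →L[ℂ] K)}
    (hI : ∀ a ∈ S, ∀ T ∈ I, ∀ T' ∈ I, a * (adjoint T ∘L T') = (adjoint T ∘L T') * a)
    (hd : (Submodule.span ℂ {y | ∃ T ∈ I, ∃ ξ, y = T ξ}).topologicalClosure = ⊤)
    (r : (H →L[ℂ] H) → (K →L[ℂ] K)) (hr : ∀ a ∈ S, ∀ T ∈ I, ∀ ξ, r a (T ξ) = T (a ξ))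
    (x y : K) (hy : ‖y‖ ≤ 1) :
    Rep S (fun a => ⟪x, r a y⟫_ℂ) (2 * ‖x‖ ^ 2) 20 := by
  have hfin : ∀ y ∈ Submodule.span ℂ {y | ∃ T ∈ I, ∃ ξ, y = T ξ}, ∀ ε : ℝ, 0 < ε →
      Rep S (fun a => ⟪x, r a y⟫_ℂ) (‖x‖ ^ 2) (‖y‖ ^ 2 + ε) := by
    intro y hy ε hε
    obtain ⟨n, f, g, rfl⟩ := Submodule.mem_span_set'.1 hy
    choose T hT ξ hξ using fun i => (g i).2
    have hsum : ∑ i, f i • (g i : K) = ∑ i, T i (f i • ξ i) := by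
      refine Finset.sum_congr rfl fun i _ => ?_
      rw [map_smul, hξ]
    have := rep_of_finite (S := S) T (fun a ha i j => hI a ha _ (hT i) _ (hT j))
      (fun i => f i • ξ i) x hε
    rw [hsum]
    refine this.congr fun a ha => ?_
    rw [map_sum]
    congr 1
    exact Finset.sum_congr rfl fun i _ => hr a ha _ (hT i) _
  have hmem : y ∈ closure ((Submodule.span ℂ {y | ∃ T ∈ I, ∃ ξ, y = T ξ}).toAddSubgroup : Set K) := by
    have : y ∈ (Submodule.span ℂ {y | ∃ T ∈ I, ∃ ξ, y = T ξ}).topologicalClosure := by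
      rw [hd]; trivial
    exact this
  obtain ⟨v, hv, hvs, hv0, hvn⟩ := controlled_sum_of_mem_closure hmem
    (b := fun n => (1 / 4 : ℝ) ^ n) (fun n => by positivity)
  have hvb : ∀ n, ‖v n‖ ≤ 2 * (1 / 4 : ℝ) ^ n := by
    intro n
    rcases Nat.eq_zero_or_pos n with rfl | hn
    · have h1 : ‖v 0‖ ≤ ‖v 0 - y‖ + ‖y‖ := by simpa using norm_add_le (v 0 - y) y
      rw [show -v 0 + y = -(v 0 - y) by abel, norm_neg, pow_zero] at hv0
      rw [pow_zero]
      linarith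
    · have := hvn n hn
      have h2 : (0 : ℝ) < (1 / 4) ^ n := by positivity
      linarith
  have hk : ∀ k, Rep S (fun a => ⟪x, r a (v k)⟫_ℂ) ((1 / 4 : ℝ) ^ k * ‖x‖ ^ 2)
      (5 * (1 / 4 : ℝ) ^ k) := by
    intro k
    have h := (hfin (v k) (hvs k) (((1 / 4 : ℝ) ^ k) ^ 2) (by positivity)).smul
      ((1 / 2 : ℝ) ^ k) (2 ^ k)
    have e2 : (((1 / 2 : ℝ) ^ k)) ^ 2 = (1 / 4) ^ k := by rw [← pow_mul, mul_comm, pow_mul]; norm_num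
    have e3 : (((2 : ℝ) ^ k)) ^ 2 * (1 / 4) ^ k = 1 := by
      rw [← pow_mul, mul_comm k, pow_mul, ← mul_pow]; norm_num
    refine (h.congr fun a _ => ?_).mono ?_ ?_
    · simp
    · rw [e2]
    · have h4 : ‖v k‖ ^ 2 ≤ (2 * (1 / 4 : ℝ) ^ k) ^ 2 := by
        have := hvb k
        gcongr
      calc (2 ^ k : ℝ) ^ 2 * (‖v k‖ ^ 2 + ((1 / 4 : ℝ) ^ k) ^ 2)
          ≤ (2 ^ k : ℝ) ^ 2 * ((2 * (1 / 4 : ℝ) ^ k) ^ 2 + ((1 / 4 : ℝ) ^ k) ^ 2) := by gcongr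
        _ = 5 * ((2 ^ k : ℝ) ^ 2 * (1 / 4 : ℝ) ^ k) * (1 / 4 : ℝ) ^ k := by ring
        _ = 5 * (1 / 4 : ℝ) ^ k := by rw [e3]; ring
  have hg : Summable fun k : ℕ => (1 / 4 : ℝ) ^ k :=
    summable_geometric_of_lt_one (by norm_num) (by norm_num)
  have hgs : ∑' k : ℕ, (1 / 4 : ℝ) ^ k = 4 / 3 := by
    rw [tsum_geometric_of_lt_one (by norm_num) (by norm_num)]; norm_num
  have hall := Rep.tsum hk (hg.mul_right _) (hg.mul_left _)
  rw [tsum_mul_right, tsum_mul_left, hgs] at hall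
  have hHS : HasSum v y := by
    have hs : Summable v := by
      refine Summable.of_norm_bounded (hg.mul_left 2) hvb
    have h1 := (hs.hasSum.tendsto_sum_nat.comp (Filter.tendsto_add_atTop_nat 1))
    have := tendsto_nhds_unique h1 hv
    rw [← this]; exact hs.hasSum
  refine (hall.congr fun a _ => ?_).mono ?_ (by norm_num)
  · have := ((innerSL ℂ x).hasSum ((r a).hasSum hHS))
    exact this.tsum_eq.symm
  · nlinarith [sq_nonneg ‖x‖]

open ContinuousLinearMap in
theorem rep_of_seq {S : Set (H →L[ℂ] H)} {I : Set (H →L[ℂ] K)}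
    (hI : ∀ a ∈ S, ∀ T ∈ I, ∀ T' ∈ I, a * (adjoint T ∘L T') = (adjoint T ∘L T') * a)
    (hd : (Submodule.span ℂ {y | ∃ T ∈ I, ∃ ξ, y = T ξ}).topologicalClosure = ⊤)
    (r : (H →L[ℂ] H) → (K →L[ℂ] K)) (hr : ∀ a ∈ S, ∀ T ∈ I, ∀ ξ, r a (T ξ) = T (a ξ))
    (x y : ℕ → K) (hx : Summable fun n => ‖x n‖ ^ 2) (hy : Summable fun n => ‖y n‖ ^ 2) :
    ∃ α β : ℝ, Rep S (fun a => ∑' n, ⟪x n, r a (y n)⟫_ℂ) α β := by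
  have hn : ∀ n, Rep S (fun a => ⟪x n, r a (y n)⟫_ℂ) (2 * ‖x n‖ ^ 2) (‖y n‖ ^ 2 * 20) := by
    intro n
    have h := (rep_of_unit hI hd r hr (x n) ((‖y n‖⁻¹ : ℂ) • y n) ?_).smul 1 ‖y n‖
    · refine (h.congr fun a _ => ?_).mono (by simp) le_rfl
      by_cases hy0 : y n = 0
      · simp [hy0]
      · have : (‖y n‖ : ℂ) ≠ 0 := by simpa using hy0
        simp only [map_smul, inner_smul_right]
        push_cast
        field_simp
    · rw [norm_smul]
      by_cases hy0 : y n = 0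
      · simp [hy0]
      · have : ‖y n‖ ≠ 0 := by simpa using hy0
        simp [this]
  exact ⟨_, _, Rep.tsum hn (hx.mul_left _) (hy.mul_right _)⟩

open ContinuousLinearMap in
theorem exists_rho {I : Set (H →L[ℂ] K)}
    (hd : (Submodule.span ℂ {y | ∃ T ∈ I, ∃ ξ, y = T ξ}).topologicalClosure = ⊤)
    (a : H →L[ℂ] H)
    (ha : ∀ T ∈ I, ∀ T' ∈ I, a * (adjoint T ∘L T') = (adjoint T ∘L T') * a) :
    ∃ r : K →L[ℂ] K, ∀ T ∈ I, ∀ ξ, r (T ξ) = T (a ξ) := by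
  have ha' : ∀ T ∈ I, ∀ T' ∈ I,
      adjoint a * (adjoint T ∘L T') = (adjoint T ∘L T') * adjoint a := by
    intro T hT T' hT'
    have h := congrArg adjoint (ha T' hT' T hT)
    simp only [mul_def, adjoint_comp, adjoint_adjoint] at h ⊢
    exact h.symm
  let P : H →L[ℂ] H := ((‖a‖ ^ 2 : ℝ) : ℂ) • (1 : H →L[ℂ] H) - adjoint a ∘L a
  have hP : P.IsPositive := by
    refine ⟨?_, fun x => ?_⟩
    · rw [← isSelfAdjoint_iff_isSymmetric]
      refine IsSelfAdjoint.sub ?_ (isPositive_adjoint_comp_self a).isSelfAdjoint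
      rw [isSelfAdjoint_iff, star_smul, star_one]
      simp
    · have h1 : ⟪P x, x⟫_ℂ = ((‖a‖ ^ 2 * ‖x‖ ^ 2 - ‖a x‖ ^ 2 : ℝ) : ℂ) := by
        have h2 : P x = ((‖a‖ ^ 2 : ℝ) : ℂ) • x - adjoint a (a x) := rfl
        rw [h2, inner_sub_left, inner_smul_left, adjoint_inner_left, inner_self_eq_norm_sq_to_K,
          inner_self_eq_norm_sq_to_K]
        simp
      rw [reApplyInnerSelf_apply, h1]
      have := a.le_opNorm x
      rw [← mul_pow]
      change 0 ≤ Complex.re (((‖a‖ * ‖x‖) ^ 2 - ‖a x‖ ^ 2 : ℝ) : ℂ)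
      rw [Complex.ofReal_re]
      have h2 : ‖a x‖ ^ 2 ≤ (‖a‖ * ‖x‖) ^ 2 := by gcongr
      linarith
  obtain ⟨b, hbsa, hbb, hbc⟩ := exists_sqrt (K := K) P hP
  have hb : ∀ T ∈ I, ∀ T' ∈ I, b * (adjoint T ∘L T') = (adjoint T ∘L T') * b := by
    intro T hT T' hT'
    refine (hbc _ ?_).symm
    simp only [P, mul_sub, sub_mul]
    congr 1
    · ext; simp
    · have e1 := ha T hT T' hT'
      have e2 := ha' T hT T' hT'
      change _ * (adjoint a * a) = (adjoint a * a) * _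
      rw [mul_assoc, e1, ← mul_assoc, ← mul_assoc, e2]
  have hD : ∀ D : H →L[ℂ] H,
      (∀ T ∈ I, ∀ T' ∈ I, D * (adjoint T ∘L T') = (adjoint T ∘L T') * D) →
      ∀ T ∈ I, ∀ T' ∈ I, ∀ ξ η, ⟪T (D ξ), T' (D η)⟫_ℂ = ⟪T ξ, T' (adjoint D (D η))⟫_ℂ := by
    intro D hD T hT T' hT' ξ η
    have h := congrArg (fun f : H →L[ℂ] H => f ξ) (hD T' hT' T hT)
    change D (adjoint T' (T ξ)) = adjoint T' (T (D ξ)) at h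
    rw [← adjoint_inner_left, ← h, ← adjoint_inner_right, adjoint_inner_left]
  let q : (I →₀ H) →ₗ[ℂ] K := Finsupp.lsum ℂ fun T => (T : H →L[ℂ] K).toLinearMap
  let p : (I →₀ H) →ₗ[ℂ] K := Finsupp.lsum ℂ fun T => ((T : H →L[ℂ] K) ∘L a).toLinearMap
  have hq : ∀ f, q f = ∑ T ∈ f.support, (T : H →L[ℂ] K) (f T) := fun f => by
    simp [q, Finsupp.sum]
  have hp : ∀ f, p f = ∑ T ∈ f.support, (T : H →L[ℂ] K) (a (f T)) := fun f => by
    simp [p, Finsupp.sum]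
  have hbound : ∀ f, ‖p f‖ ≤ ‖a‖ * ‖q f‖ := by
    intro f
    have h1 : ∀ D : H →L[ℂ] H,
        (∀ T ∈ I, ∀ T' ∈ I, D * (adjoint T ∘L T') = (adjoint T ∘L T') * D) →
        ⟪∑ T ∈ f.support, (T : H →L[ℂ] K) (D (f T)), ∑ T ∈ f.support, (T : H →L[ℂ] K) (D (f T))⟫_ℂ
        = ⟪q f, ∑ T ∈ f.support, (T : H →L[ℂ] K) (adjoint D (D (f T)))⟫_ℂ := by
      intro D h
      rw [hq]
      simp only [sum_inner, inner_sum]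
      exact Finset.sum_congr rfl fun T _ => Finset.sum_congr rfl fun T' _ =>
        hD D h T' T'.2 T T.2 _ _
    have h2 := h1 a ha
    have h3 := h1 b hb
    have h4 : ∑ T ∈ f.support, (T : H →L[ℂ] K) (adjoint a (a (f T))) +
        ∑ T ∈ f.support, (T : H →L[ℂ] K) (adjoint b (b (f T))) = ((‖a‖ ^ 2 : ℝ) : ℂ) • q f := by
      rw [hq, ← Finset.sum_add_distrib, Finset.smul_sum]
      refine Finset.sum_congr rfl fun T _ => ?_
      rw [← map_add, ← map_smul]
      congr 1
      rw [hbsa]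
      have : b (b (f T)) = P (f T) := by rw [← hbb]; rfl
      rw [this]
      simp [P]
    have h5 := congrArg₂ (· + ·) h2 h3
    simp only [← inner_add_right, h4, inner_smul_right, inner_self_eq_norm_sq_to_K, ← hp] at h5
    have h6 := congrArg Complex.re h5
    simp only [Complex.add_re, Complex.re_ofReal_mul] at h6
    simp only [Complex.coe_algebraMap, ← Complex.ofReal_pow, Complex.ofReal_re] at h6
    refine le_of_sq_le_sq ?_ (by positivity)
    rw [mul_pow]
    nlinarith [sq_nonneg ‖∑ T ∈ f.support, (T : H →L[ℂ] K) (b (f T))‖]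
  have hdr : DenseRange q := by
    have : (Submodule.span ℂ {y | ∃ T ∈ I, ∃ ξ, y = T ξ}) ≤ LinearMap.range q := by
      rw [Submodule.span_le]
      rintro _ ⟨T, hT, ξ, rfl⟩
      exact ⟨Finsupp.single ⟨T, hT⟩ ξ, by simp [q]⟩
    have h2 := Submodule.topologicalClosure_mono this
    rw [hd, top_le_iff, ← Submodule.dense_iff_topologicalClosure_eq_top] at h2
    exact h2
  refine ⟨p.extendOfNorm q, fun T hT ξ => ?_⟩
  have h1 : q (Finsupp.single ⟨T, hT⟩ ξ) = T ξ := by simp [q]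
  have h2 : p (Finsupp.single ⟨T, hT⟩ ξ) = T (a ξ) := by simp [p]
  rw [← h1, ← h2]
  exact LinearMap.extendOfNorm_eq hdr ⟨_, hbound⟩ _

theorem ext_of_dense {I : Set (H →L[ℂ] K)}
    (hd : (Submodule.span ℂ {y | ∃ T ∈ I, ∃ ξ, y = T ξ}).topologicalClosure = ⊤)
    {r s : K →L[ℂ] K} (h : ∀ T ∈ I, ∀ ξ, r (T ξ) = s (T ξ)) : r = s := by
  refine ContinuousLinearMap.ext_on (s := {y | ∃ T ∈ I, ∃ ξ, y = T ξ}) ?_ ?_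
  · exact Submodule.dense_iff_topologicalClosure_eq_top.2 hd
  · rintro _ ⟨T, hT, ξ, rfl⟩
    exact h T hT ξ

open ContinuousLinearMap in
/-- The identity representation of a self-adjoint algebra of operators separates each
representation whose vector functionals are ultraweakly continuous. -/
theorem separating_of_normal (A : StarSubalgebra ℂ (H →L[ℂ] H)) (π : A →⋆ₐ[ℂ] (K →L[ℂ] K))
    (hπ : ∀ η : K, ∃ x y : ℕ → H, Summable (fun n => ‖x n‖ ^ 2) ∧ Summable (fun n => ‖y n‖ ^ 2) ∧
      ∀ a : A, ⟪η, π a η⟫_ℂ = ∑' n, ⟪x n, (a : H →L[ℂ] H) (y n)⟫_ℂ) :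
    (Submodule.span ℂ {k | ∃ T : H →L[ℂ] K, (∀ a : A, T ∘L (a : H →L[ℂ] H) = π a ∘L T) ∧
      ∃ ξ, k = T ξ}).topologicalClosure = ⊤ := by
  set V := (Submodule.span ℂ {k | ∃ T : H →L[ℂ] K, (∀ a : A, T ∘L (a : H →L[ℂ] H) = π a ∘L T) ∧
      ∃ ξ, k = T ξ}).topologicalClosure with hV
  have hVc : IsClosed (V : Set K) := Submodule.isClosed_topologicalClosure _
  have : CompleteSpace V := hVc.completeSpace_coe
  rw [← Submodule.orthogonal_eq_bot_iff, Submodule.eq_bot_iff]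
  intro η hη
  obtain ⟨x, y, hx, hy, hxy⟩ := hπ η
  have hzm : Memℓp (Sum.elim x y : ℕ ⊕ ℕ → H) 2 := by
    refine memℓp_gen ?_
    simp only [ENNReal.toReal_ofNat, Real.rpow_ofNat]
    exact (hx.hasSum.sum (f := fun i => ‖Sum.elim x y i‖ ^ 2) hy.hasSum).summable
  let z : lp (fun _ : ℕ ⊕ ℕ => H) 2 := ⟨Sum.elim x y, hzm⟩
  let q : A →ₗ[ℂ] lp (fun _ : ℕ ⊕ ℕ => H) 2 :=
    { toFun := fun c => diag _ (c : H →L[ℂ] H) z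
      map_add' := fun c d => by ext i; rfl
      map_smul' := fun c d => by ext i; rfl }
  let p : A →ₗ[ℂ] K :=
    { toFun := fun c => π c η
      map_add' := fun c d => by simp
      map_smul' := fun c d => by simp }
  have hbound : ∀ c, ‖p c‖ ≤ 1 * ‖q c‖ := by
    intro c
    rw [one_mul]
    refine le_of_sq_le_sq ?_ (norm_nonneg _)
    have hsq : ∀ w : ℕ → H, Summable (fun n => ‖w n‖ ^ 2) →
        Summable (fun n => ‖(c : H →L[ℂ] H) (w n)‖ ^ 2) := fun w hw => by
      refine Summable.of_nonneg_of_le (fun n => sq_nonneg _) (fun n => ?_)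
        (hw.mul_left (‖(c : H →L[ℂ] H)‖ ^ 2))
      rw [← mul_pow]
      have := (c : H →L[ℂ] H).le_opNorm (w n)
      gcongr
    have h1 : ⟪η, π (star c * c) η⟫_ℂ = ((‖p c‖ ^ 2 : ℝ) : ℂ) := by
      rw [map_mul, map_star]
      change ⟪η, adjoint (π c) (π c η)⟫_ℂ = _
      rw [adjoint_inner_right, inner_self_eq_norm_sq_to_K]
      simp [p]
    have h2 : ‖q c‖ ^ 2 = ∑' n, (‖(c : H →L[ℂ] H) (x n)‖ ^ 2 + ‖(c : H →L[ℂ] H) (y n)‖ ^ 2) := by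
      have := lp.norm_rpow_eq_tsum (p := 2) (by norm_num) (q c)
      simp only [ENNReal.toReal_ofNat, Real.rpow_ofNat] at this
      rw [this, (hsq x hx).tsum_add (hsq y hy)]
      exact ((hsq x hx).hasSum.sum (f := fun i => ‖q c i‖ ^ 2) (hsq y hy).hasSum).tsum_eq
    have h3 : ((‖p c‖ ^ 2 : ℝ) : ℂ) = ∑' n, ⟪(c : H →L[ℂ] H) (x n), (c : H →L[ℂ] H) (y n)⟫_ℂ := by
      rw [← h1, hxy]
      refine tsum_congr fun n => ?_
      change ⟪x n, adjoint (c : H →L[ℂ] H) ((c : H →L[ℂ] H) (y n))⟫_ℂ = _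
      rw [adjoint_inner_right]
    have h4 : ‖p c‖ ^ 2 = ‖((‖p c‖ ^ 2 : ℝ) : ℂ)‖ := by
      rw [Complex.norm_real, Real.norm_eq_abs, abs_of_nonneg (sq_nonneg _)]
    rw [h4, h3, h2]
    refine tsum_of_norm_bounded ((hsq x hx).add (hsq y hy)).hasSum fun n => ?_
    refine (norm_inner_le_norm _ _).trans ?_
    nlinarith [sq_nonneg (‖(c : H →L[ℂ] H) (x n)‖ - ‖(c : H →L[ℂ] H) (y n)‖),
      sq_nonneg ‖(c : H →L[ℂ] H) (x n)‖, sq_nonneg ‖(c : H →L[ℂ] H) (y n)‖]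
  let W := (LinearMap.range q).topologicalClosure
  have hWc : IsClosed (W : Set (lp (fun _ : ℕ ⊕ ℕ => H) 2)) := Submodule.isClosed_topologicalClosure _
  have : CompleteSpace W := hWc.completeSpace_coe
  have hqW : ∀ c, q c ∈ W := fun c =>
    Submodule.le_topologicalClosure _ (LinearMap.mem_range_self q c)
  let q' : A →ₗ[ℂ] W := q.codRestrict W hqW
  have hq' : DenseRange q' := by
    rintro ⟨w, hw⟩
    rw [closure_subtype]
    have hw' : w ∈ closure (LinearMap.range q : Set (lp (fun _ : ℕ ⊕ ℕ => H) 2)) := hw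
    refine closure_mono ?_ hw'
    rintro _ ⟨c, rfl⟩
    exact ⟨q' c, ⟨c, rfl⟩, rfl⟩
  let T : lp (fun _ : ℕ ⊕ ℕ => H) 2 →L[ℂ] K := p.extendOfNorm q' ∘L W.orthogonalProjectionOnto
  have hTq : ∀ c, T (q c) = p c := by
    intro c
    have h1 : W.orthogonalProjectionOnto (q c) = q' c :=
      Submodule.orthogonalProjectionOnto_mem_subspace_eq_self (K := W) (q' c)
    change p.extendOfNorm q' (W.orthogonalProjectionOnto (q c)) = _
    rw [h1]
    exact LinearMap.extendOfNorm_eq hq' ⟨1, hbound⟩ c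
  have hTW : ∀ v ∈ Wᗮ, T v = 0 := by
    intro v hv
    have h1 := Submodule.orthogonalProjectionOnto_eq_zero_iff.2 hv
    change p.extendOfNorm q' (W.orthogonalProjectionOnto v) = _
    rw [h1, map_zero]
  have hDq : ∀ (a : A) c, diag _ (a : H →L[ℂ] H) (q c) = q (a * c) := fun a c => by
    ext i; rfl
  have hDW : ∀ (a : A), ∀ w ∈ W, diag _ (a : H →L[ℂ] H) w ∈ W := by
    intro a w hw
    have hw' : w ∈ closure (LinearMap.range q : Set (lp (fun _ : ℕ ⊕ ℕ => H) 2)) := hw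
    refine map_mem_closure (diag _ (a : H →L[ℂ] H)).continuous hw' ?_
    rintro _ ⟨c, rfl⟩
    exact ⟨a * c, (hDq a c).symm⟩
  have hTi : ∀ (a : A) v, T (diag _ (a : H →L[ℂ] H) v) = π a (T v) := by
    intro a v
    obtain ⟨w, hw, w', hw', rfl⟩ := W.exists_add_mem_mem_orthogonal v
    have h1 : diag _ (a : H →L[ℂ] H) w' ∈ Wᗮ := by
      rw [Submodule.mem_orthogonal]
      intro u hu
      rw [← inner_conj_symm, diag_adjoint_inner, inner_conj_symm]
      exact (Submodule.mem_orthogonal _ _).1 hw' _ (hDW (star a) u hu)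
    rw [map_add, map_add, map_add, map_add, hTW _ h1, hTW _ hw', map_zero, add_zero, add_zero]
    have hw2 : w ∈ closure (LinearMap.range q : Set (lp (fun _ : ℕ ⊕ ℕ => H) 2)) := hw
    refine closure_minimal (t := {w | T (diag _ (a : H →L[ℂ] H) w) = π a (T w)}) ?_
      (isClosed_eq (by fun_prop) (by fun_prop)) hw2
    rintro _ ⟨c, rfl⟩
    change T (diag _ (a : H →L[ℂ] H) (q c)) = π a (T (q c))
    rw [hDq, hTq, hTq]
    simp [p]
  have hmem : ∀ i ξ, T (lp.single 2 i ξ) ∈ V := by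
    intro i ξ
    refine Submodule.le_topologicalClosure _ (Submodule.subset_span ?_)
    refine ⟨T ∘L lp.singleContinuousLinearMap ℂ (fun _ : ℕ ⊕ ℕ => H) 2 i, fun a => ?_, ξ, rfl⟩
    ext ξ'
    change T (lp.single 2 i ((a : H →L[ℂ] H) ξ')) = π a (T (lp.single 2 i ξ'))
    rw [← hTi]
    congr 1
    ext j
    rw [diag_apply]
    by_cases h : j = i
    · subst h; simp
    · simp [h]
  have hηz : T z = η := by
    have h1 : z = q 1 := by ext i; rfl
    rw [h1, hTq]
    simp [p]
  have hηV : η ∈ V := by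
    have h1 := T.hasSum (lp.hasSum_single (p := 2) (by norm_num) z)
    rw [hηz] at h1
    refine hVc.mem_of_tendsto h1 (Filter.Eventually.of_forall fun s => ?_)
    exact Submodule.sum_mem _ fun i _ => hmem i _
  have h := (Submodule.mem_orthogonal _ _).1 hη η hηV
  exact inner_self_eq_zero.1 h

end Analysis

/-! ### Hilbert spaces, von Neumann algebras and normal maps -/

/-- A (complex) Hilbert space. -/
structure HilbertSp : Type (u + 1) where
  carrier : Type u
  [normedAddCommGroup : NormedAddCommGroup carrier]
  [innerProductSpace : InnerProductSpace ℂ carrier]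
  [completeSpace : CompleteSpace carrier]

instance : CoeSort HilbertSp.{u} (Type u) := ⟨HilbertSp.carrier⟩

attribute [instance] HilbertSp.normedAddCommGroup HilbertSp.innerProductSpace
  HilbertSp.completeSpace

/-- A von Neumann algebra `A ⊆ L(H)`. -/
structure VNAlg : Type (u + 1) where
  H : HilbertSp.{u}
  alg : VonNeumannAlgebra H

/-- The elements of a von Neumann algebra, as a unital complex star algebra. -/
abbrev VNAlg.El (A : VNAlg.{u}) : Type u := A.alg.toStarSubalgebra

/-- A map `f : A → L(K)` is normal (ultraweakly continuous) if it pulls back the ultraweakly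
continuous functionals `∑ ⟨x n, · (y n)⟩` on `L(K)`, for square-summable sequences `x`, `y`, to
functionals of this form on `A ⊆ L(H)`. -/
def IsNormal (A : VNAlg.{u}) {K : HilbertSp.{u}} (f : A.El → (K →L[ℂ] K)) : Prop :=
  ∀ x y : ℕ → K, Summable (fun n => ‖x n‖ ^ 2) → Summable (fun n => ‖y n‖ ^ 2) →
    ∃ v w : ℕ → A.H, Summable (fun n => ‖v n‖ ^ 2) ∧ Summable (fun n => ‖w n‖ ^ 2) ∧
      ∀ a : A.El, ∑' n, ⟪x n, f a (y n)⟫_ℂ = ∑' n, ⟪v n, (a : A.H →L[ℂ] A.H) (w n)⟫_ℂ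

theorem IsNormal.val (A : VNAlg.{u}) : IsNormal A (fun a => (a : A.H →L[ℂ] A.H)) :=
  fun x y hx hy => ⟨x, y, hx, hy, fun _ => rfl⟩

theorem IsNormal.comp {A B : VNAlg.{u}} {K : HilbertSp.{u}} {f : B.El → (K →L[ℂ] K)}
    (hf : IsNormal B f) {φ : A.El → B.El} (hφ : IsNormal A fun a => (φ a : B.H →L[ℂ] B.H)) :
    IsNormal A fun a => f (φ a) := by
  intro x y hx hy
  obtain ⟨v, w, hv, hw, h⟩ := hf x y hx hy
  obtain ⟨v', w', hv', hw', h'⟩ := hφ v w hv hw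
  exact ⟨v', w', hv', hw', fun a => (h _).trans (h' a)⟩

open ContinuousLinearMap in
theorem IsNormal.conj {A : VNAlg.{u}} {K L : HilbertSp.{u}} {f : A.El → (K →L[ℂ] K)}
    (hf : IsNormal A f) (S : K →L[ℂ] L) (T : L →L[ℂ] K) :
    IsNormal A fun a => S ∘L f a ∘L T := by
  intro x y hx hy
  have aux : ∀ {L' K' : HilbertSp.{u}} (R : L' →L[ℂ] K') (z : ℕ → L'),
      Summable (fun n => ‖z n‖ ^ 2) → Summable (fun n => ‖R (z n)‖ ^ 2) := by
    intro L' K' R z hz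
    refine Summable.of_nonneg_of_le (fun n => sq_nonneg _) (fun n => ?_) (hz.mul_left (‖R‖ ^ 2))
    rw [← mul_pow]
    have := R.le_opNorm (z n)
    gcongr
  obtain ⟨v, w, hv, hw, h⟩ := hf (fun n => adjoint S (x n)) (fun n => T (y n))
    (aux _ _ hx) (aux _ _ hy)
  refine ⟨v, w, hv, hw, fun a => ?_⟩
  rw [← h]
  exact tsum_congr fun n => (adjoint_inner_left S _ _).symm

/-! ### The category of bimodules over `N` -/

/-- An `N`-bimodule `(H, ρ, σ)`: a Hilbert space with a faithful, normal, unital representation `ρ`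
and a faithful, normal, unital antirepresentation `σ` of `N` that commute. -/
structure Bimod (N : VNAlg.{u}) : Type (u + 1) where
  H : HilbertSp.{u}
  lact : N.El →⋆ₐ[ℂ] (H →L[ℂ] H)
  ract : N.Elᵐᵒᵖ →⋆ₐ[ℂ] (H →L[ℂ] H)
  lact_normal : IsNormal N fun a => lact a
  ract_normal : IsNormal N fun a => ract (op a)
  lact_injective : Function.Injective lact
  ract_injective : Function.Injective ract
  comm : ∀ a b, lact a * ract b = ract b * lact a

/-- A morphism of `N`-bimodules: a bounded operator that intertwines both actions. -/
@[ext]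
structure Bimod.Hom {N : VNAlg.{u}} (X Y : Bimod N) : Type u where
  opr : X.H →L[ℂ] Y.H
  lact_comm : ∀ a, opr ∘L X.lact a = Y.lact a ∘L opr
  ract_comm : ∀ a, opr ∘L X.ract a = Y.ract a ∘L opr

instance (N : VNAlg.{u}) : Category.{u} (Bimod N) where
  Hom := Bimod.Hom
  id X := ⟨ContinuousLinearMap.id ℂ X.H, fun _ => rfl, fun _ => rfl⟩
  comp {X Y Z} S T := ⟨T.opr ∘L S.opr,
    fun a => by
      rw [ContinuousLinearMap.comp_assoc, S.lact_comm, ← ContinuousLinearMap.comp_assoc,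
        T.lact_comm, ContinuousLinearMap.comp_assoc],
    fun a => by
      rw [ContinuousLinearMap.comp_assoc, S.ract_comm, ← ContinuousLinearMap.comp_assoc,
        T.ract_comm, ContinuousLinearMap.comp_assoc]⟩

namespace Bimod

variable {N : VNAlg.{u}}

@[simp] theorem id_opr (X : Bimod N) : Hom.opr (𝟙 X) = ContinuousLinearMap.id ℂ X.H := rfl

@[simp] theorem comp_opr {X Y Z : Bimod N} (S : X ⟶ Y) (T : Y ⟶ Z) :
    Hom.opr (S ≫ T) = T.opr ∘L S.opr := rfl

@[ext] theorem hom_ext {X Y : Bimod N} {S T : X ⟶ Y} (h : S.opr = T.opr) : S = T := Hom.ext h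

open ContinuousLinearMap in
/-- The adjoint of a morphism of bimodules. -/
noncomputable def adj {X Y : Bimod N} (T : X ⟶ Y) : Y ⟶ X where
  opr := adjoint T.opr
  lact_comm a := by
    have h := congrArg adjoint (T.lact_comm (star a))
    rw [adjoint_comp, adjoint_comp, ← star_eq_adjoint (X.lact _), ← star_eq_adjoint (Y.lact _),
      ← map_star, ← map_star, star_star] at h
    exact h.symm
  ract_comm a := by
    have h := congrArg adjoint (T.ract_comm (star a))
    rw [adjoint_comp, adjoint_comp, ← star_eq_adjoint (X.ract _), ← star_eq_adjoint (Y.ract _),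
      ← map_star, ← map_star, star_star] at h
    exact h.symm

theorem adjoint_eqToHom {X Y : Bimod N} (h : X = Y) :
    ContinuousLinearMap.adjoint (Hom.opr (eqToHom h)) = Hom.opr (eqToHom h.symm) := by
  subst h
  simp only [eqToHom_refl, id_opr]
  exact ContinuousLinearMap.adjoint_id

theorem eqToHom_opr_comp {X Y : Bimod N} (h : X = Y) :
    Hom.opr (eqToHom h.symm) ∘L Hom.opr (eqToHom h) = ContinuousLinearMap.id ℂ X.H := by
  subst h; rfl

theorem mk_eq (X : Bimod N) {l : N.El →⋆ₐ[ℂ] (X.H →L[ℂ] X.H)} {r : N.Elᵐᵒᵖ →⋆ₐ[ℂ] (X.H →L[ℂ] X.H)}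
    (hl : l = X.lact) (hr : r = X.ract) (h1 h2 h3 h4 h5) :
    (⟨X.H, l, r, h1, h2, h3, h4, h5⟩ : Bimod N) = X := by
  subst hl hr; rfl

/-- Bimodule morphisms with equal underlying operators are equal, also when the source and the
target are only propositionally equal. -/
theorem hom_heq {X X' Y Y' : Bimod N} (hX : X = X') (hY : Y = Y') (T : X ⟶ Y) (T' : X' ⟶ Y')
    (h : HEq T.opr T'.opr) : HEq T T' := by
  subst hX hY
  exact heq_of_eq (hom_ext (eq_of_heq h))

end Bimod

/-! ### The 2-category of von Neumann algebras over `N` -/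

/-- A von Neumann algebra `A` with a normal unital embedding `ι` and a normal unital anti-embedding
`ιop` of `N` with commuting images. -/
structure WObj (N : VNAlg.{u}) : Type (u + 1) extends VNAlg.{u} where
  ι : N.El →⋆ₐ[ℂ] toVNAlg.El
  ιop : N.Elᵐᵒᵖ →⋆ₐ[ℂ] toVNAlg.El
  ι_normal : IsNormal N fun a => (ι a : H →L[ℂ] H)
  ιop_normal : IsNormal N fun a => (ιop (op a) : H →L[ℂ] H)
  ι_injective : Function.Injective ι
  ιop_injective : Function.Injective ιop
  comm : ∀ a b, ι a * ιop b = ιop b * ι a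

/-- A morphism: a normal unital `*`-homomorphism that preserves the (anti-)embeddings of `N`. -/
@[ext]
structure WObj.Hom {N : VNAlg.{u}} (A B : WObj N) : Type u where
  hom : A.El →⋆ₐ[ℂ] B.El
  normal : IsNormal A.toVNAlg fun a => (hom a : B.H →L[ℂ] B.H)
  hom_ι : hom.comp A.ι = B.ι
  hom_ιop : hom.comp A.ιop = B.ιop

/-- A 2-cell from `φ` to `ψ`: an element `b` of the target with `b φ(a) = ψ(a) b` for all `a`. -/
@[ext]
structure WObj.Hom₂ {N : VNAlg.{u}} {A B : WObj N} (φ ψ : WObj.Hom A B) : Type u where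
  val : B.El
  comm : ∀ a, val * φ.hom a = ψ.hom a * val

namespace WObj

variable {N : VNAlg.{u}}

noncomputable instance : CategoryStruct.{u} (WObj N) where
  Hom := Hom
  id A := ⟨StarAlgHom.id ℂ A.El, IsNormal.val _, rfl, rfl⟩
  comp {A B C} φ ψ := ⟨ψ.hom.comp φ.hom, ψ.normal.comp φ.normal,
    by rw [StarAlgHom.comp_assoc, φ.hom_ι, ψ.hom_ι],
    by rw [StarAlgHom.comp_assoc, φ.hom_ιop, ψ.hom_ιop]⟩

@[simp] theorem id_hom (A : WObj N) (a : A.El) : Hom.hom (𝟙 A) a = a := rfl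

@[simp] theorem comp_hom {A B C : WObj N} (φ : A ⟶ B) (ψ : B ⟶ C) (a : A.El) :
    Hom.hom (φ ≫ ψ) a = ψ.hom (φ.hom a) := rfl

noncomputable instance (A B : WObj N) : Category.{u} (A ⟶ B) where
  Hom φ ψ := Hom₂ φ ψ
  id φ := ⟨1, fun a => by simp⟩
  comp b c := ⟨c.val * b.val, fun a => by rw [mul_assoc, b.comm, ← mul_assoc, c.comm, mul_assoc]⟩
  id_comp b := Hom₂.ext (mul_one _)
  comp_id b := Hom₂.ext (one_mul _)
  assoc b c d := Hom₂.ext (mul_assoc _ _ _).symm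

@[simp] theorem id_val {A B : WObj N} (φ : A ⟶ B) : Hom₂.val (𝟙 φ) = 1 := rfl

@[simp] theorem comp_val {A B : WObj N} {φ ψ χ : A ⟶ B} (b : φ ⟶ ψ) (c : ψ ⟶ χ) :
    Hom₂.val (b ≫ c) = c.val * b.val := rfl

@[ext] theorem hom₂_ext {A B : WObj N} {φ ψ : A ⟶ B} {b c : φ ⟶ ψ} (h : b.val = c.val) : b = c :=
  Hom₂.ext h

theorem eqToHom_val {A B : WObj N} {φ ψ : A ⟶ B} (h : φ = ψ) : Hom₂.val (eqToHom h) = 1 := by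
  subst h; rfl

/-- The invertible 2-cell given by `1` between morphisms with the same underlying map. -/
noncomputable def oneIso {A B : WObj N} (φ ψ : A ⟶ B) (h : ∀ a, φ.hom a = ψ.hom a) : φ ≅ ψ where
  hom := ⟨1, fun a => by simp [h]⟩
  inv := ⟨1, fun a => by simp [h]⟩
  hom_inv_id := Hom₂.ext (mul_one _)
  inv_hom_id := Hom₂.ext (mul_one _)

@[simp] theorem oneIso_hom_val {A B : WObj N} (φ ψ : A ⟶ B) (h) :
    Hom₂.val (oneIso φ ψ h).hom = 1 := rfl

@[simp] theorem oneIso_inv_val {A B : WObj N} (φ ψ : A ⟶ B) (h) :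
    Hom₂.val (oneIso φ ψ h).inv = 1 := rfl

/-- Whiskering a 2-cell `c : ψ ⟶ ψ'` with `φ : A ⟶ B`: the element `c`. -/
noncomputable def whiskerL {A B C : WObj N} (φ : A ⟶ B) {ψ ψ' : B ⟶ C} (c : ψ ⟶ ψ') : φ ≫ ψ ⟶ φ ≫ ψ' :=
  Hom₂.mk (Hom₂.val c) fun a => Hom₂.comm c (φ.hom a)

/-- Whiskering a 2-cell `b : φ ⟶ φ'` with `ψ : B ⟶ C`: the element `ψ(b)`. -/
noncomputable def whiskerR {A B C : WObj N} {φ φ' : A ⟶ B} (b : φ ⟶ φ') (ψ : B ⟶ C) : φ ≫ ψ ⟶ φ' ≫ ψ :=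
  Hom₂.mk (ψ.hom (Hom₂.val b)) fun a => by
    rw [comp_hom, comp_hom, ← map_mul, ← map_mul, Hom₂.comm b]

@[simp] theorem whiskerL_val {A B C : WObj N} (φ : A ⟶ B) {ψ ψ' : B ⟶ C} (c : ψ ⟶ ψ') :
    Hom₂.val (whiskerL φ c) = Hom₂.val c := rfl

@[simp] theorem whiskerR_val {A B C : WObj N} {φ φ' : A ⟶ B} (b : φ ⟶ φ') (ψ : B ⟶ C) :
    Hom₂.val (whiskerR b ψ) = ψ.hom (Hom₂.val b) := rfl

/-- The 2-category of von Neumann algebras over `N`. The horizontal composite of `b : φ₁ ⟶ φ₂` and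
`c : ψ₁ ⟶ ψ₂`, where `φᵢ : A ⟶ B` and `ψᵢ : B ⟶ C`, is `ψ₂(b) c = c ψ₁(b)`. -/
noncomputable instance : Bicategory.{u, u} (WObj N) where
  whiskerLeft φ ψ ψ' c := whiskerL φ c
  whiskerRight b ψ := whiskerR b ψ
  associator φ ψ χ := oneIso _ _ fun _ => rfl
  leftUnitor φ := oneIso _ _ fun _ => rfl
  rightUnitor φ := oneIso _ _ fun _ => rfl
  whisker_exchange {A B C φ φ' ψ ψ'} b c := Hom₂.ext (Hom₂.comm c (Hom₂.val b)).symm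

instance : Bicategory.Strict (WObj N) where
  leftUnitor_eqToIso φ := by
    ext1; apply hom₂_ext; rw [eqToIso.hom, eqToHom_val]; rfl
  rightUnitor_eqToIso φ := by
    ext1; apply hom₂_ext; rw [eqToIso.hom, eqToHom_val]; rfl
  associator_eqToIso φ ψ χ := by
    ext1; apply hom₂_ext; rw [eqToIso.hom, eqToHom_val]; rfl

end WObj

/-! ### The 2-category of categories over the category of `N`-bimodules -/

/-- The bounded operator underlying `f : X ⟶ Y` in a category over `N`-bimodules. -/
def opOf {N : VNAlg.{u}} {C : Type (u + 1)} [Category.{u} C] (U : C ⥤ Bimod N) {X Y : C}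
    (f : X ⟶ Y) : (U.obj X).H →L[ℂ] (U.obj Y).H := Bimod.Hom.opr (U.map f)

/-- `G` is separating if for every `X` the vectors `H(f) ξ`, where `f : G ⟶ X` and `ξ ∈ H(G)`, span a
dense subspace of `H(X)`. -/
def IsSeparating {N : VNAlg.{u}} {C : Type (u + 1)} [Category.{u} C] (U : C ⥤ Bimod N) (G : C) :
    Prop :=
  ∀ X : C, (Submodule.span ℂ {y | ∃ T ∈ Set.range (fun f : G ⟶ X => opOf U f), ∃ ξ, y = T ξ}).topologicalClosure = ⊤

/-- A category over the category of `N`-bimodules that has a separating object: a category `C` with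
a functor `U` to `N`-bimodules such that the adjoint of each `U(f)`, `f : X ⟶ Y`, is of the form
`U(g)` for some `g : Y ⟶ X`. -/
structure CatN (N : VNAlg.{u}) : Type (u + 2) where
  C : Type (u + 1)
  [cat : Category.{u} C]
  U : C ⥤ Bimod N
  star_closed : ∀ {X Y : C} (f : X ⟶ Y), ∃ g : Y ⟶ X, U.map g = Bimod.adj (U.map f)
  exists_separating : ∃ G : C, IsSeparating U G

attribute [instance] CatN.cat

/-- A morphism of categories over `N`-bimodules: a functor `F` with `U F = U` (on the nose). -/
@[ext]
structure CatN.Hom {N : VNAlg.{u}} (C D : CatN N) : Type (u + 1) where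
  F : C.C ⥤ D.C
  w : F ⋙ D.U = C.U

/-- A 2-cell: an arbitrary natural transformation. -/
@[ext]
structure CatN.Hom₂ {N : VNAlg.{u}} {C D : CatN N} (F G : CatN.Hom C D) : Type (u + 1) where
  nt : F.F ⟶ G.F

namespace CatN

variable {N : VNAlg.{u}}

instance : CategoryStruct.{u + 1} (CatN N) where
  Hom := Hom
  id C := ⟨𝟭 C.C, rfl⟩
  comp F G := ⟨F.F ⋙ G.F, by rw [Functor.assoc, G.w, F.w]⟩

@[simp] theorem id_F (C : CatN N) : Hom.F (𝟙 C) = 𝟭 C.C := rfl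

@[simp] theorem comp_F {C D E : CatN N} (F : C ⟶ D) (G : D ⟶ E) :
    Hom.F (F ≫ G) = F.F ⋙ G.F := rfl

instance (C D : CatN N) : Category.{u + 1} (C ⟶ D) where
  Hom F G := Hom₂ F G
  id F := ⟨𝟙 F.F⟩
  comp α β := ⟨α.nt ≫ β.nt⟩
  id_comp _ := Hom₂.ext (Category.id_comp _)
  comp_id _ := Hom₂.ext (Category.comp_id _)
  assoc _ _ _ := Hom₂.ext (Category.assoc _ _ _)

@[simp] theorem id_nt {C D : CatN N} (F : C ⟶ D) : Hom₂.nt (𝟙 F) = 𝟙 F.F := rfl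

@[simp] theorem comp_nt {C D : CatN N} {F G H : C ⟶ D} (α : F ⟶ G) (β : G ⟶ H) :
    Hom₂.nt (α ≫ β) = α.nt ≫ β.nt := rfl

@[ext] theorem hom₂_ext {C D : CatN N} {F G : C ⟶ D} {α β : F ⟶ G} (h : α.nt = β.nt) : α = β :=
  Hom₂.ext h

theorem eqToHom_nt {C D : CatN N} {F G : C ⟶ D} (h : F = G) :
    Hom₂.nt (eqToHom h) = eqToHom (congrArg Hom.F h) := by
  subst h; rfl

/-- Natural isomorphisms give invertible 2-cells. -/
def isoMk {C D : CatN N} {F G : C ⟶ D} (e : F.F ≅ G.F) : F ≅ G where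
  hom := Hom₂.mk e.hom
  inv := Hom₂.mk e.inv
  hom_inv_id := Hom₂.ext e.hom_inv_id
  inv_hom_id := Hom₂.ext e.inv_hom_id

@[simp] theorem isoMk_hom_nt {C D : CatN N} {F G : C ⟶ D} (e : F.F ≅ G.F) :
    Hom₂.nt (isoMk e).hom = e.hom := rfl

@[simp] theorem isoMk_inv_nt {C D : CatN N} {F G : C ⟶ D} (e : F.F ≅ G.F) :
    Hom₂.nt (isoMk e).inv = e.inv := rfl

/-- Left whiskering of a natural transformation with a functor. -/
def whiskerL {B C D : CatN N} (F : B ⟶ C) {G G' : C ⟶ D} (β : G ⟶ G') : F ≫ G ⟶ F ≫ G' :=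
  Hom₂.mk (Functor.whiskerLeft F.F (Hom₂.nt β))

/-- Right whiskering of a natural transformation with a functor. -/
def whiskerR {B C D : CatN N} {F F' : B ⟶ C} (α : F ⟶ F') (G : C ⟶ D) : F ≫ G ⟶ F' ≫ G :=
  Hom₂.mk (Functor.whiskerRight (Hom₂.nt α) G.F)

@[simp] theorem whiskerL_nt_app {B C D : CatN N} (F : B ⟶ C) {G G' : C ⟶ D} (β : G ⟶ G')
    (X : B.C) : (Hom₂.nt (whiskerL F β)).app X = (Hom₂.nt β).app (F.F.obj X) := rfl

@[simp] theorem whiskerR_nt_app {B C D : CatN N} {F F' : B ⟶ C} (α : F ⟶ F') (G : C ⟶ D)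
    (X : B.C) : (Hom₂.nt (whiskerR α G)).app X = G.F.map ((Hom₂.nt α).app X) := rfl

/-- The 2-category of categories over `N`-bimodules with a separating object. -/
instance : Bicategory.{u + 1, u + 1} (CatN N) where
  whiskerLeft F _ _ β := whiskerL F β
  whiskerRight α G := whiskerR α G
  associator F G H := isoMk (F := (F ≫ G) ≫ H) (G := F ≫ G ≫ H) (Functor.associator F.F G.F H.F)
  leftUnitor F := isoMk (F := 𝟙 _ ≫ F) (G := F) F.F.leftUnitor
  rightUnitor F := isoMk (F := F ≫ 𝟙 _) (G := F) F.F.rightUnitor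
  whiskerLeft_id := by intros; ext X; simp
  whiskerLeft_comp := by intros; ext X; simp
  id_whiskerLeft := by intros; ext X; simp
  comp_whiskerLeft := by intros; ext X; simp
  id_whiskerRight := by intros; ext X; simp
  comp_whiskerRight := by intros; ext X; simp
  whiskerRight_id := by intros; ext X; simp
  whiskerRight_comp := by intros; ext X; simp
  whisker_assoc := by intros; ext X; simp
  whisker_exchange := by intros; ext X; simp
  pentagon := by intros; ext X; simp
  triangle := by intros; ext X; simp

instance : Bicategory.Strict (CatN N) where
  leftUnitor_eqToIso F := by
    ext1; apply hom₂_ext; rw [eqToIso.hom, eqToHom_nt]; rfl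
  rightUnitor_eqToIso F := by
    ext1; apply hom₂_ext; rw [eqToIso.hom, eqToHom_nt]; rfl
  associator_eqToIso F G H := by
    ext1; apply hom₂_ext; rw [eqToIso.hom, eqToHom_nt]; rfl

end CatN

/-! ### The functor `Mod` -/

/-- An object of `Mod(A)`: a normal unital representation `π` of `A` such that `π ∘ ι` and
`π ∘ ιop` are faithful. -/
structure ModObj {N : VNAlg.{u}} (A : WObj N) : Type (u + 1) where
  H : HilbertSp.{u}
  π : A.El →⋆ₐ[ℂ] (H →L[ℂ] H)
  normal : IsNormal A.toVNAlg fun a => π a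
  injective_ι : Function.Injective fun n => π (A.ι n)
  injective_ιop : Function.Injective fun n => π (A.ιop n)

/-- A morphism of `Mod(A)`: a bounded intertwiner. -/
@[ext]
structure ModObj.Hom {N : VNAlg.{u}} {A : WObj N} (X Y : ModObj A) : Type u where
  opr : X.H →L[ℂ] Y.H
  comm : ∀ a, opr ∘L X.π a = Y.π a ∘L opr

namespace ModObj

variable {N : VNAlg.{u}} {A : WObj N}

instance : Category.{u} (ModObj A) where
  Hom := Hom
  id X := ⟨ContinuousLinearMap.id ℂ X.H, fun _ => rfl⟩
  comp {X Y Z} S T := ⟨T.opr ∘L S.opr, fun a => by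
    rw [ContinuousLinearMap.comp_assoc, S.comm, ← ContinuousLinearMap.comp_assoc,
      T.comm, ContinuousLinearMap.comp_assoc]⟩

@[simp] theorem id_opr (X : ModObj A) : Hom.opr (𝟙 X) = ContinuousLinearMap.id ℂ X.H := rfl

@[simp] theorem comp_opr {X Y Z : ModObj A} (S : X ⟶ Y) (T : Y ⟶ Z) :
    Hom.opr (S ≫ T) = T.opr ∘L S.opr := rfl

@[ext] theorem hom_ext {X Y : ModObj A} {S T : X ⟶ Y} (h : S.opr = T.opr) : S = T := Hom.ext h

/-- The bimodule `(H, π ∘ ι, π ∘ ιop)`. -/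
noncomputable def toBimod (X : ModObj A) : Bimod N where
  H := X.H
  lact := X.π.comp A.ι
  ract := X.π.comp A.ιop
  lact_normal := X.normal.comp A.ι_normal
  ract_normal := X.normal.comp (φ := fun a => A.ιop (op a)) A.ιop_normal
  lact_injective := X.injective_ι
  ract_injective := X.injective_ιop
  comm a b := by
    change X.π (A.ι a) * X.π (A.ιop b) = X.π (A.ιop b) * X.π (A.ι a)
    rw [← map_mul, A.comm, map_mul]

/-- The forgetful functor `(H, π) ↦ (H, π ∘ ι, π ∘ ιop)`, `T ↦ T`. -/
noncomputable def forget (A : WObj N) : ModObj A ⥤ Bimod N where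
  obj := toBimod
  map T := Bimod.Hom.mk (X := toBimod _) (Y := toBimod _) T.opr (fun a => T.comm (A.ι a))
    (fun a => T.comm (A.ιop a))

open ContinuousLinearMap in
/-- The adjoint of an intertwiner. -/
noncomputable def adj {X Y : ModObj A} (T : X ⟶ Y) : Y ⟶ X where
  opr := adjoint T.opr
  comm a := by
    have h := congrArg adjoint (T.comm (star a))
    rw [adjoint_comp, adjoint_comp, ← star_eq_adjoint (X.π _), ← star_eq_adjoint (Y.π _),
      ← map_star, ← map_star, star_star] at h
    exact h.symm

/-- The identity representation of `A ⊆ L(H)`. -/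
noncomputable def idRep (A : WObj N) : ModObj A where
  H := A.H
  π := A.alg.toStarSubalgebra.subtype
  normal := IsNormal.val _
  injective_ι := Subtype.val_injective.comp A.ι_injective
  injective_ιop := Subtype.val_injective.comp A.ιop_injective

theorem idRep_separating (A : WObj N) : IsSeparating (forget A) (idRep A) := by
  intro X
  have h := separating_of_normal A.alg.toStarSubalgebra X.π (fun η => by
    classical
    obtain ⟨v, w, hv, hw, h⟩ := X.normal (Pi.single 0 η) (Pi.single 0 η)
      (summable_of_ne_finset_zero (s := {0}) fun n hn => by simp at hn; simp [hn])
      (summable_of_ne_finset_zero (s := {0}) fun n hn => by simp at hn; simp [hn])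
    refine ⟨v, w, hv, hw, fun a => ?_⟩
    rw [← h, tsum_eq_single 0 (fun n hn => by simp [hn])]
    simp)
  refine top_le_iff.1 (h.ge.trans (Submodule.topologicalClosure_mono (Submodule.span_mono ?_)))
  rintro k ⟨T, hT, ξ, rfl⟩
  exact ⟨T, ⟨Hom.mk (X := idRep A) (Y := X) T hT, rfl⟩, ξ, rfl⟩

end ModObj

/-- `Mod(A)` as a category over `N`-bimodules. -/
noncomputable def modObj {N : VNAlg.{u}} (A : WObj N) : CatN N where
  C := ModObj A
  U := ModObj.forget A
  star_closed f := ⟨ModObj.adj f, rfl⟩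
  exists_separating := ⟨ModObj.idRep A, ModObj.idRep_separating A⟩

/-- The representation `(H, π ∘ φ)` of `A` for a representation `(H, π)` of `B`. -/
noncomputable def pullbackObj {N : VNAlg.{u}} {A B : WObj N} (φ : A ⟶ B) (X : ModObj B) :
    ModObj A where
  H := X.H
  π := X.π.comp φ.hom
  normal := X.normal.comp φ.normal
  injective_ι := by
    have h : ∀ n, φ.hom (A.ι n) = B.ι n := fun n => DFunLike.congr_fun φ.hom_ι n
    simpa [h] using X.injective_ι
  injective_ιop := by
    have h : ∀ n, φ.hom (A.ιop n) = B.ιop n := fun n => DFunLike.congr_fun φ.hom_ιop n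
    simpa [h] using X.injective_ιop

/-- The functor `φ^* : Mod(B) ⥤ Mod(A)`, `(H, π) ↦ (H, π ∘ φ)`, `T ↦ T`. -/
noncomputable def pullback {N : VNAlg.{u}} {A B : WObj N} (φ : A ⟶ B) : ModObj B ⥤ ModObj A where
  obj := pullbackObj φ
  map {X Y} T := ModObj.Hom.mk (X := pullbackObj φ X) (Y := pullbackObj φ Y)
    (ModObj.Hom.opr (X := X) (Y := Y) T)
    fun a => ModObj.Hom.comm (X := X) (Y := Y) T (φ.hom a)

theorem pullback_forget {N : VNAlg.{u}} {A B : WObj N} (φ : A ⟶ B) :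
    pullback φ ⋙ ModObj.forget A = ModObj.forget B := by
  have h : ∀ X : ModObj B, (pullback φ ⋙ ModObj.forget A).obj X = (ModObj.forget B).obj X := by
    intro X
    refine Bimod.mk_eq ((ModObj.forget B).obj X) ?_ ?_ _ _ _ _ _
    · change (X.π.comp φ.hom).comp A.ι = X.π.comp B.ι
      rw [StarAlgHom.comp_assoc, φ.hom_ι]
    · change (X.π.comp φ.hom).comp A.ιop = X.π.comp B.ιop
      rw [StarAlgHom.comp_assoc, φ.hom_ιop]
  exact CategoryTheory.Functor.hext h fun X Y T =>
    Bimod.hom_heq (h X) (h Y) _ _ (heq_of_eq (a := ModObj.Hom.opr T) rfl)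

/-- The morphism `φ^*` of categories over `N`-bimodules. -/
noncomputable def modMap {N : VNAlg.{u}} {A B : WObj N} (φ : A ⟶ B) : modObj B ⟶ modObj A :=
  CatN.Hom.mk (C := modObj B) (D := modObj A) (pullback φ) (pullback_forget φ)

/-- The natural transformation `(π(b))_{(H, π)}` from `φ^*` to `ψ^*`. -/
noncomputable def modMap₂ {N : VNAlg.{u}} {A B : WObj N} {φ ψ : A ⟶ B} (b : φ ⟶ ψ) :
    modMap φ ⟶ modMap ψ :=
  CatN.Hom₂.mk
    { app := fun X => ModObj.Hom.mk (X := pullbackObj φ X) (Y := pullbackObj ψ X)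
        (ModObj.π X (WObj.Hom₂.val b)) fun a => by
          change X.π _ * X.π (φ.hom a) = X.π (ψ.hom a) * X.π _
          rw [← map_mul, ← map_mul, WObj.Hom₂.comm b]
      naturality := fun X Y T =>
        ModObj.Hom.ext (ModObj.Hom.comm (X := X) (Y := Y) T (WObj.Hom₂.val b)).symm }

/-- The data of the contravariant 2-functor `Mod`: `A ↦ Mod(A)`, `φ ↦ φ^*`, `b ↦ (π(b))_{(H, π)}`. -/
noncomputable def modData (N : VNAlg.{u}) : PrelaxFunctorStruct (WObj N)ᵒᵖ (CatN N) where
  obj A := modObj A.unop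
  map φ := modMap φ.unop
  map₂ b := modMap₂ b.unop2

/-! ### The functor `End` -/

/-- A choice of a separating object of `C`. -/
structure CatN.Sep {N : VNAlg.{u}} (C : CatN N) : Type (u + 1) where
  obj : C.C
  sep : IsSeparating C.U obj

section EndObj

open ContinuousLinearMap (adjoint)

variable {N : VNAlg.{u}} (C : CatN N) (G : C.Sep)

theorem opOf_id (X : C.C) : opOf C.U (𝟙 X) = ContinuousLinearMap.id ℂ (C.U.obj X).H := by
  simp [opOf]

theorem opOf_comp {X Y Z : C.C} (f : X ⟶ Y) (g : Y ⟶ Z) :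
    opOf C.U (f ≫ g) = opOf C.U g ∘L opOf C.U f := by
  simp [opOf]

theorem exists_adjoint {X Y : C.C} (f : X ⟶ Y) :
    ∃ g : Y ⟶ X, opOf C.U g = adjoint (opOf C.U f) := by
  obtain ⟨g, hg⟩ := C.star_closed f
  exact ⟨g, congrArg Bimod.Hom.opr hg⟩

/-- The commutant `H(C(G, G))'`. The set `H(C(G, G))` is closed under adjoints, so that passing to
its star-closure in the definition has no effect, see `mem_endAlg`. -/
noncomputable def endAlg : VonNeumannAlgebra (C.U.obj G.obj).H where
  toStarSubalgebra := StarSubalgebra.centralizer ℂ (Set.range fun f : G.obj ⟶ G.obj => opOf C.U f)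
  centralizer_centralizer' := by
    change Set.centralizer (Set.centralizer (SetLike.coe (StarSubalgebra.centralizer ℂ _))) =
      SetLike.coe (StarSubalgebra.centralizer ℂ _)
    rw [StarSubalgebra.coe_centralizer, Set.centralizer_centralizer_centralizer]

theorem mem_endAlg (S : (C.U.obj G.obj).H →L[ℂ] (C.U.obj G.obj).H) :
    S ∈ (endAlg C G).toStarSubalgebra ↔
      ∀ f : G.obj ⟶ G.obj, S ∘L opOf C.U f = opOf C.U f ∘L S := by
  change S ∈ StarSubalgebra.centralizer ℂ _ ↔ _
  rw [StarSubalgebra.mem_centralizer_iff]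
  constructor
  · exact fun h f => (h _ ⟨f, rfl⟩).1.symm
  · rintro h _ ⟨f, rfl⟩
    obtain ⟨g, hg⟩ := exists_adjoint C f
    refine ⟨(h f).symm, ?_⟩
    rw [ContinuousLinearMap.star_eq_adjoint, ← hg]
    exact (h g).symm

theorem lact_mem_endAlg (a : N.El) :
    (C.U.obj G.obj).lact a ∈ (endAlg C G).toStarSubalgebra :=
  (mem_endAlg C G _).2 fun f => ((C.U.map f).lact_comm a).symm

theorem ract_mem_endAlg (a : N.Elᵐᵒᵖ) :
    (C.U.obj G.obj).ract a ∈ (endAlg C G).toStarSubalgebra :=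
  (mem_endAlg C G _).2 fun f => ((C.U.map f).ract_comm a).symm

/-- The von Neumann algebra `End(C) = H(C(G, G))'` with the (anti-)embeddings `ρ` and `σ` of `N`,
where `U(G) = (H, ρ, σ)`. -/
noncomputable def endObj : WObj N where
  H := (C.U.obj G.obj).H
  alg := endAlg C G
  ι := (C.U.obj G.obj).lact.codRestrict _ (lact_mem_endAlg C G)
  ιop := (C.U.obj G.obj).ract.codRestrict _ (ract_mem_endAlg C G)
  ι_normal := (C.U.obj G.obj).lact_normal
  ιop_normal := (C.U.obj G.obj).ract_normal
  ι_injective _ _ h := (C.U.obj G.obj).lact_injective (congrArg Subtype.val h)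
  ιop_injective _ _ h := (C.U.obj G.obj).ract_injective (congrArg Subtype.val h)
  comm a b := Subtype.ext ((C.U.obj G.obj).comm a b)

variable {C}

/-- The operator on `H(G)` given by an element of `End(C)`. -/
def endVal (a : (endObj C G).El) : (C.U.obj G.obj).H →L[ℂ] (C.U.obj G.obj).H := a.1

theorem endObj_comm (a : (endObj C G).El) (X : C.C) :
    ∀ T ∈ Set.range (fun f : G.obj ⟶ X => opOf C.U f),
      ∀ T' ∈ Set.range (fun f : G.obj ⟶ X => opOf C.U f),
        endVal G a * (adjoint T ∘L T') =
          (adjoint T ∘L T') * endVal G a := by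
  rintro _ ⟨f, rfl⟩ _ ⟨f', rfl⟩
  obtain ⟨g, hg⟩ := exists_adjoint C f
  dsimp only
  rw [← hg, ← opOf_comp]
  exact (mem_endAlg C G _).1 a.2 _

/-- The operator `ρ^X(a)` on `H(X)`, for `a ∈ End(C)`, determined by `ρ^X(a) T = T a` for all
`T ∈ H(C(G, X))`. -/
noncomputable def rhoFun (X : C.C) (a : (endObj C G).El) :
    (C.U.obj X).H →L[ℂ] (C.U.obj X).H :=
  (exists_rho (G.sep X) (endVal G a)
    (endObj_comm G a X)).choose

theorem rhoFun_apply (X : C.C) (a : (endObj C G).El) (f : G.obj ⟶ X) (ξ : (C.U.obj G.obj).H) :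
    rhoFun G X a (opOf C.U f ξ) =
      opOf C.U f (endVal G a ξ) :=
  (exists_rho (G.sep X) (endVal G a)
    (endObj_comm G a X)).choose_spec _ ⟨f, rfl⟩ ξ

theorem ext_of_sep {X : C.C} {r s : (C.U.obj X).H →L[ℂ] (C.U.obj X).H}
    (h : ∀ (f : G.obj ⟶ X) (ξ : (C.U.obj G.obj).H), r (opOf C.U f ξ) = s (opOf C.U f ξ)) :
    r = s :=
  ext_of_dense (G.sep X) (by rintro _ ⟨f, rfl⟩ ξ; exact h f ξ)

theorem inner_ext_of_sep {X : C.C} {x y : (C.U.obj X).H}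
    (h : ∀ (f : G.obj ⟶ X) (ξ : (C.U.obj G.obj).H), ⟪x, opOf C.U f ξ⟫_ℂ = ⟪y, opOf C.U f ξ⟫_ℂ) :
    x = y := by
  have h1 : innerSL ℂ x = innerSL ℂ y := by
    refine ContinuousLinearMap.ext_on
      (Submodule.dense_iff_topologicalClosure_eq_top.2 (G.sep X)) ?_
    rintro _ ⟨_, ⟨f, rfl⟩, ξ, rfl⟩
    exact h f ξ
  exact ext_inner_right ℂ fun v => DFunLike.congr_fun h1 v

/-- The normal unital representation `ρ^X` of `End(C)` on `H(X)`. -/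
noncomputable def rho (X : C.C) :
    (endObj C G).El →⋆ₐ[ℂ] ((C.U.obj X).H →L[ℂ] (C.U.obj X).H) where
  toFun := rhoFun G X
  map_one' := ext_of_sep G fun f ξ => by rw [rhoFun_apply]; rfl
  map_mul' a b := ext_of_sep G fun f ξ => by
    rw [rhoFun_apply, ContinuousLinearMap.mul_def, ContinuousLinearMap.comp_apply, rhoFun_apply, rhoFun_apply]
    rfl
  map_zero' := ext_of_sep G fun f ξ => by
    rw [rhoFun_apply]
    exact map_zero _
  map_add' a b := ext_of_sep G fun f ξ => by
    rw [rhoFun_apply]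
    change _ = rhoFun G X a _ + rhoFun G X b _
    rw [rhoFun_apply, rhoFun_apply, ← map_add]
    rfl
  commutes' c := ext_of_sep G fun f ξ => by
    rw [rhoFun_apply]
    change opOf C.U f (c • ξ) = c • opOf C.U f ξ
    rw [map_smul]
  map_star' a := by
    refine ext_of_sep G fun f ξ => ?_
    rw [rhoFun_apply, ContinuousLinearMap.star_eq_adjoint]
    refine inner_ext_of_sep G fun f' ξ' => ?_
    rw [ContinuousLinearMap.adjoint_inner_left, rhoFun_apply]
    have h := endObj_comm G (star a) X _ ⟨f', rfl⟩ _ ⟨f, rfl⟩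
    have h' := congrArg (fun T : (C.U.obj G.obj).H →L[ℂ] (C.U.obj G.obj).H => ⟪T ξ, ξ'⟫_ℂ) h
    have e : endVal G (star a) = adjoint (endVal G a) := rfl
    simp only [mul_apply_eq_comp, ContinuousLinearMap.comp_apply, e,
      ContinuousLinearMap.adjoint_inner_left] at h' ⊢
    exact h'.symm

theorem rho_apply (X : C.C) (a : (endObj C G).El) (f : G.obj ⟶ X) (ξ : (C.U.obj G.obj).H) :
    rho G X a (opOf C.U f ξ) = opOf C.U f (endVal G a ξ) := rhoFun_apply G X a f ξ

theorem rho_normal (X : C.C) : IsNormal (endObj C G).toVNAlg (fun a => rho G X a) := by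
  classical
  intro x y hx hy
  obtain ⟨α, β, v, w, hv, -, hw, -, h⟩ := rep_of_seq
    (S := (endAlg C G).toStarSubalgebra)
    (I := Set.range fun f : G.obj ⟶ X => opOf C.U f)
    (fun a ha => endObj_comm G ⟨a, ha⟩ X) (G.sep X)
    (fun a => if ha : a ∈ (endAlg C G).toStarSubalgebra then rho G X ⟨a, ha⟩ else 0)
    (by
      rintro a ha _ ⟨f, rfl⟩ ξ
      rw [dif_pos (SetLike.mem_coe.1 ha)]
      exact rho_apply G X ⟨a, ha⟩ f ξ) x y hx hy
  refine ⟨v, w, hv, hw, fun a => ?_⟩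
  have ha : endVal G a ∈ (endAlg C G).toStarSubalgebra := a.2
  refine Eq.trans ?_ (h (endVal G a) ha)
  simp only [dif_pos ha]
  rfl

theorem rho_naturality {X Y : C.C} (f : X ⟶ Y) (a : (endObj C G).El) :
    opOf C.U f ∘L rho G X a = rho G Y a ∘L opOf C.U f := by
  refine ContinuousLinearMap.ext_on
    (Submodule.dense_iff_topologicalClosure_eq_top.2 (G.sep X)) ?_
  rintro _ ⟨_, ⟨g, rfl⟩, ξ, rfl⟩
  have h : ∀ ζ, opOf C.U f (opOf C.U g ζ) = opOf C.U (g ≫ f) ζ := fun ζ => by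
    rw [opOf_comp]; rfl
  simp only [ContinuousLinearMap.comp_apply, rho_apply, h]

theorem rho_ι (X : C.C) (n : N.El) : rho G X ((endObj C G).ι n) = (C.U.obj X).lact n :=
  ext_of_sep G fun f ξ => by
    rw [rho_apply]
    exact DFunLike.congr_fun ((C.U.map f).lact_comm n) ξ

theorem rho_ιop (X : C.C) (n : N.Elᵐᵒᵖ) : rho G X ((endObj C G).ιop n) = (C.U.obj X).ract n :=
  ext_of_sep G fun f ξ => by
    rw [rho_apply]
    exact DFunLike.congr_fun ((C.U.map f).ract_comm n) ξ

/-- The object `(H(X), ρ^X)` of `Mod(End(C))`. -/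
noncomputable def etaObj (X : C.C) : ModObj (endObj C G) where
  H := (C.U.obj X).H
  π := rho G X
  normal := rho_normal G X
  injective_ι := by simpa only [rho_ι] using (C.U.obj X).lact_injective
  injective_ιop := by simpa only [rho_ιop] using (C.U.obj X).ract_injective

/-- The functor `X ↦ (H(X), ρ^X)`, `T ↦ H(T)`. -/
noncomputable def etaFunctor : C.C ⥤ ModObj (endObj C G) where
  obj := etaObj G
  map {X Y} f := ModObj.Hom.mk (X := etaObj G X) (Y := etaObj G Y) (opOf C.U f)
    (rho_naturality G f)
  map_id X := ModObj.Hom.ext (opOf_id C X)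
  map_comp f g := ModObj.Hom.ext (opOf_comp C f g)

variable (C) in
/-- The morphism `η_C : C ⟶ Mod(End(C))`. -/
noncomputable def eta : C ⟶ modObj (endObj C G) :=
  CatN.Hom.mk (C := C) (D := modObj (endObj C G)) (etaFunctor G) (by
    have h : ∀ X : C.C, (ModObj.forget (endObj C G)).obj (etaObj G X) = C.U.obj X := fun X =>
      Bimod.mk_eq (C.U.obj X) (StarAlgHom.ext fun n => rho_ι G X n)
        (StarAlgHom.ext fun n => rho_ιop G X n) _ _ _ _ _
    exact CategoryTheory.Functor.hext h fun X Y f =>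
      Bimod.hom_heq (h X) (h Y) _ _ (heq_of_eq (a := opOf C.U f) rfl))

end EndObj

/-- Transport of operators along an equality of bimodules. -/
noncomputable def transport {N : VNAlg.{u}} {P P' Q Q' : Bimod N} (h : P = Q) (h' : P' = Q')
    (T : P.H →L[ℂ] P'.H) : Q.H →L[ℂ] Q'.H :=
  Bimod.Hom.opr (eqToHom h') ∘L T ∘L Bimod.Hom.opr (eqToHom h.symm)

theorem transport_comp {N : VNAlg.{u}} {P P' P'' Q Q' Q'' : Bimod N} (h : P = Q) (h' : P' = Q')
    (h'' : P'' = Q'') (S : P'.H →L[ℂ] P''.H) (T : P.H →L[ℂ] P'.H) :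
    transport h h'' (S ∘L T) = transport h' h'' S ∘L transport h h' T := by
  subst h h' h''; rfl

theorem transport_id {N : VNAlg.{u}} {P Q : Bimod N} (h : P = Q) :
    transport h h (ContinuousLinearMap.id ℂ P.H) = ContinuousLinearMap.id ℂ Q.H := by
  subst h; rfl

theorem transport_lact {N : VNAlg.{u}} {P Q : Bimod N} (h : P = Q) (n : N.El) :
    transport h h (P.lact n) = Q.lact n := by
  subst h; rfl

theorem transport_ract {N : VNAlg.{u}} {P Q : Bimod N} (h : P = Q) (n : N.Elᵐᵒᵖ) :
    transport h h (P.ract n) = Q.ract n := by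
  subst h; rfl

/-- Transport of operators along an equality of bimodules, as a `*`-homomorphism. -/
noncomputable def transportHom {N : VNAlg.{u}} {P Q : Bimod N} (h : P = Q) :
    (P.H →L[ℂ] P.H) →⋆ₐ[ℂ] (Q.H →L[ℂ] Q.H) where
  toFun := transport h h
  map_one' := by subst h; rfl
  map_mul' _ _ := by subst h; rfl
  map_zero' := by subst h; rfl
  map_add' _ _ := by subst h; rfl
  commutes' _ := by subst h; rfl
  map_star' _ := by subst h; rfl

namespace CatN.Hom

variable {N : VNAlg.{u}} {C D : CatN N}

/-- The equality `U(F(X)) = U(X)` of bimodules. -/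
theorem obj_eq (F : C ⟶ D) (X : C.C) : D.U.obj (F.F.obj X) = C.U.obj X :=
  Functor.congr_obj F.w X

theorem transport_map (F : C ⟶ D) {X Y : C.C} (f : X ⟶ Y) :
    transport (obj_eq F X) (obj_eq F Y) (opOf D.U (F.F.map f)) = opOf C.U f := by
  have h : C.U.map f = eqToHom (obj_eq F X).symm ≫ D.U.map (F.F.map f) ≫ eqToHom (obj_eq F Y) :=
    Functor.congr_hom F.w.symm f
  rw [opOf, opOf, h]
  rfl

end CatN.Hom

section HomOf

variable {N : VNAlg.{u}} {C D : CatN N} (G : C.Sep) {B : WObj N}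

/-- For a morphism `F : C ⟶ D`, a normal representation `θ` of `B` on `H(F(G)) = H(G)` that is
compatible with the actions of `N` and commutes with `H(F(f))` for all `f : G ⟶ G`, regarded as a
morphism from `B` to `End(C)`. -/
noncomputable def homOf (F : C ⟶ D)
    (θ : B.El →⋆ₐ[ℂ] ((D.U.obj (F.F.obj G.obj)).H →L[ℂ] (D.U.obj (F.F.obj G.obj)).H))
    (hθ : IsNormal B.toVNAlg fun b => θ b)
    (hι : ∀ n, θ (B.ι n) = (D.U.obj (F.F.obj G.obj)).lact n)
    (hιop : ∀ n, θ (B.ιop n) = (D.U.obj (F.F.obj G.obj)).ract n)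
    (hc : ∀ (f : G.obj ⟶ G.obj) b, opOf D.U (F.F.map f) ∘L θ b = θ b ∘L opOf D.U (F.F.map f)) :
    B ⟶ endObj C G :=
  WObj.Hom.mk (A := B) (B := endObj C G)
    (((transportHom (F.obj_eq G.obj)).comp θ).codRestrict _ fun b =>
      (mem_endAlg C G _).2 fun f => by
        have h := congrArg (transport (F.obj_eq G.obj) (F.obj_eq G.obj)) (hc f b)
        rw [transport_comp _ (F.obj_eq G.obj), transport_comp _ (F.obj_eq G.obj),
          F.transport_map] at h
        exact h.symm)
    (hθ.conj _ _)
    (by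
      refine StarAlgHom.ext fun n => Subtype.ext ?_
      change transport (F.obj_eq G.obj) (F.obj_eq G.obj) (θ (B.ι n)) = (C.U.obj G.obj).lact n
      rw [hι, transport_lact])
    (by
      refine StarAlgHom.ext fun n => Subtype.ext ?_
      change transport (F.obj_eq G.obj) (F.obj_eq G.obj) (θ (B.ιop n)) = (C.U.obj G.obj).ract n
      rw [hιop, transport_ract])

/-- For a natural transformation `α : F ⟶ F'`, the element `H(α_G)` of `End(C)`, as a 2-cell. -/
noncomputable def cellOf {F F' : C ⟶ D} {θ hθ hι hιop hc θ' hθ' hι' hιop' hc'} (α : F ⟶ F')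
    (hα : ∀ b : B.El, opOf D.U (α.nt.app G.obj) ∘L θ b = θ' b ∘L opOf D.U (α.nt.app G.obj)) :
    homOf G F θ hθ hι hιop hc ⟶ homOf G F' θ' hθ' hι' hιop' hc' :=
  WObj.Hom₂.mk
    ⟨transport (F.obj_eq G.obj) (F'.obj_eq G.obj) (opOf D.U (α.nt.app G.obj)),
      (mem_endAlg C G _).2 fun f => by
        have h := congrArg (opOf D.U) (α.nt.naturality f)
        rw [opOf_comp, opOf_comp] at h
        have h' := congrArg (transport (F.obj_eq G.obj) (F'.obj_eq G.obj)) h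
        rw [transport_comp _ (F.obj_eq G.obj), transport_comp _ (F'.obj_eq G.obj),
          F.transport_map, F'.transport_map] at h'
        exact h'⟩
    fun b => Subtype.ext (by
      have h := congrArg (transport (F.obj_eq G.obj) (F'.obj_eq G.obj)) (hα b)
      rw [transport_comp _ (F.obj_eq G.obj), transport_comp _ (F'.obj_eq G.obj)] at h
      exact h)

end HomOf

section TwoFunctors

variable {N : VNAlg.{u}}

/-- The morphism `End(F) : End(D) ⟶ End(C)`, `a ↦ ρ^{F(G_C)}(a)`. -/
noncomputable def endMap (G : ∀ C : CatN N, C.Sep) {C D : CatN N} (F : C ⟶ D) :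
    endObj D (G D) ⟶ endObj C (G C) :=
  homOf (G C) F (rho (G D) (F.F.obj (G C).obj)) (rho_normal _ _) (rho_ι _ _) (rho_ιop _ _)
    fun f a => rho_naturality (G D) (F.F.map f) a

/-- The 2-cell `End(α) = H(α_{G_C})`. -/
noncomputable def endMap₂ (G : ∀ C : CatN N, C.Sep) {C D : CatN N} {F F' : C ⟶ D} (α : F ⟶ F') :
    endMap G F ⟶ endMap G F' :=
  cellOf (G C) α fun b => rho_naturality (G D) (α.nt.app (G C).obj) b

/-- The data of the contravariant 2-functor `End`: `C ↦ H(C(G_C, G_C))'`, `F ↦ ρ^{F(G_C)}`,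
`α ↦ H(α_{G_C})`. -/
noncomputable def endData (G : ∀ C : CatN N, C.Sep) :
    PrelaxFunctorStruct (CatN N)ᵒᵖ (WObj N) where
  obj C := endObj C.unop (G C.unop)
  map F := endMap G F.unop
  map₂ α := endMap₂ G α.unop2

/-- The morphism `Φ(F) : A ⟶ End(C)` for `F : C ⟶ Mod(A)`, where `F(G_C) = (H(G_C), Φ(F))`. -/
noncomputable def phiObj {C : CatN N} (G : C.Sep) {A : WObj N} (F : C ⟶ modObj A) :
    A ⟶ endObj C G :=
  homOf G F (F.F.obj G.obj).π (F.F.obj G.obj).normal (fun _ => rfl) (fun _ => rfl)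
    fun f a => ModObj.Hom.comm (F.F.map f) a

/-- The functor `Φ : F ↦ Φ(F)`, `α ↦ α_{G_C}`. -/
noncomputable def Phi {C : CatN N} (G : C.Sep) (A : WObj N) :
    (C ⟶ modObj A) ⥤ (A ⟶ endObj C G) where
  obj F := phiObj G F
  map α := cellOf G α fun a => ModObj.Hom.comm (α.nt.app G.obj) a
  map_id F := WObj.Hom₂.ext (Subtype.ext (transport_id (F.obj_eq G.obj)))
  map_comp {F F' F''} α β := WObj.Hom₂.ext (Subtype.ext (transport_comp (F.obj_eq G.obj)
    (F'.obj_eq G.obj) (F''.obj_eq G.obj) (ModObj.Hom.opr (β.nt.app G.obj))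
    (ModObj.Hom.opr (α.nt.app G.obj))))

/-- The functor `Ψ : π ↦ Mod(π) ∘ η_C`, `S ↦ (ρ^X(S))_X`. -/
noncomputable def Psi {C : CatN N} (G : C.Sep) (A : WObj N) :
    (A ⟶ endObj C G) ⥤ (C ⟶ modObj A) where
  obj π := eta C G ≫ modMap π
  map {π π'} S := CatN.Hom₂.mk
    { app := fun X => ModObj.Hom.mk (X := pullbackObj π (etaObj G X))
        (Y := pullbackObj π' (etaObj G X)) (rho G X (WObj.Hom₂.val S)) fun a => by
          change rho G X _ * rho G X (π.hom a) = rho G X (π'.hom a) * rho G X _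
          rw [← map_mul, ← map_mul, WObj.Hom₂.comm S]
      naturality := fun X Y f => ModObj.Hom.ext (rho_naturality G f (WObj.Hom₂.val S)).symm }
  map_id π := by
    refine CatN.Hom₂.ext (NatTrans.ext (funext fun X => ModObj.Hom.ext ?_))
    exact map_one (rho G X)
  map_comp S T := by
    refine CatN.Hom₂.ext (NatTrans.ext (funext fun X => ModObj.Hom.ext ?_))
    exact map_mul (rho G X) _ _

/-- The morphism `ε_A = ρ^{Id_A} : End(Mod(A)) ⟶ A`. -/
noncomputable def epsilon (A : WObj N) (G : (modObj A).Sep) : endObj (modObj A) G ⟶ A :=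
  WObj.Hom.mk (A := endObj (modObj A) G) (B := A)
    ((rho G (ModObj.idRep A)).codRestrict _ fun a => by
      rw [← VonNeumannAlgebra.commutant_commutant A.alg]
      refine VonNeumannAlgebra.mem_commutant_iff.2 fun T hT => ?_
      have h := rho_naturality G (X := ModObj.idRep A) (Y := ModObj.idRep A)
        (ModObj.Hom.mk (X := ModObj.idRep A) (Y := ModObj.idRep A) T fun b =>
          (VonNeumannAlgebra.mem_commutant_iff.1 hT b.1 b.2).symm) a
      exact h)
    (rho_normal G (ModObj.idRep A))
    (StarAlgHom.ext fun n => Subtype.ext (rho_ι G (ModObj.idRep A) n))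
    (StarAlgHom.ext fun n => Subtype.ext (rho_ιop G (ModObj.idRep A) n))

end TwoFunctors

section Adjunction

open Bicategory
open _root_.Bicategory.Opposite (op2)

/-- The data `P` form a functor of 2-categories (of categories enriched over categories): `P` is a
functor on all categories of morphisms and preserves identities and horizontal composition. -/
def IsTwoFunctor {B : Type*} [Bicategory B] {C : Type*} [Bicategory C]
    (P : PrelaxFunctorStruct B C) : Prop :=
  ∃ S : StrictPseudofunctor B C, S.toPrelaxFunctorStruct = P

/-- `Φ` with inverse `Ψ` is an adjunction, with unit `η` and counit `κ`, between contravariant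
2-functors `M` and `E`. -/
structure IsAdjunction {W : Type*} [Bicategory W] {C : Type*} [Bicategory C]
    (M : PrelaxFunctorStruct Wᵒᵖ C) (E : PrelaxFunctorStruct Cᵒᵖ W)
    (Φ : ∀ (c : C) (a : W), (c ⟶ M.obj (.op a)) ⥤ (a ⟶ E.obj (.op c)))
    (Ψ : ∀ (c : C) (a : W), (a ⟶ E.obj (.op c)) ⥤ (c ⟶ M.obj (.op a)))
    (η : ∀ c : C, c ⟶ M.obj (.op (E.obj (.op c))))
    (κ : ∀ a : W, E.obj (.op (M.obj (.op a))) ⟶ a) : Prop where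
  /-- `Ψ` is inverse to `Φ`. -/
  left_inv : ∀ c a, Φ c a ⋙ Ψ c a = 𝟭 _
  right_inv : ∀ c a, Ψ c a ⋙ Φ c a = 𝟭 _
  /-- `Φ` is natural with respect to morphisms. -/
  nat_obj : ∀ {c d : C} {a b : W} (f : c ⟶ d) (x : d ⟶ M.obj (.op b)) (g : a ⟶ b),
    (Φ c a).obj (f ≫ x ≫ M.map g.op) = g ≫ (Φ d b).obj x ≫ E.map f.op
  /-- `Φ` is natural with respect to 2-cells. -/
  nat_map : ∀ {c d : C} {a b : W} {f f' : c ⟶ d} (α : f ⟶ f') {x x' : d ⟶ M.obj (.op b)}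
    (ξ : x ⟶ x') {g g' : a ⟶ b} (β : g ⟶ g'),
    (Φ c a).map (α ▷ _ ≫ f' ◁ (ξ ▷ _ ≫ x' ◁ M.map₂ (op2 β))) =
      eqToHom (nat_obj f x g) ≫
        (β ▷ _ ≫ g' ◁ ((Φ d b).map ξ ▷ _ ≫ (Φ d b).obj x' ◁ E.map₂ (op2 α))) ≫
          eqToHom (nat_obj f' x' g').symm
  /-- The unit corresponds to the identity. -/
  unit : ∀ c, (Φ c (E.obj (.op c))).obj (η c) = 𝟙 _
  /-- The counit is inverse to the morphism that corresponds to the identity. -/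
  counit_left : ∀ a, κ a ≫ (Φ (M.obj (.op a)) a).obj (𝟙 _) = 𝟙 _
  counit_right : ∀ a, (Φ (M.obj (.op a)) a).obj (𝟙 _) ≫ κ a = 𝟙 _
  /-- The triangle identities. -/
  triangle_left : ∀ a, η (M.obj (.op a)) ≫ M.map ((Φ (M.obj (.op a)) a).obj (𝟙 _)).op = 𝟙 _
  triangle_right : ∀ c,
    (Φ (M.obj (.op (E.obj (.op c)))) (E.obj (.op c))).obj (𝟙 _) ≫ E.map (η c).op = 𝟙 _

end Adjunction

end VNCat

/-! Everything rests on one principle: a family of operators that is natural over `C` is determined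
by its component at the separating object. If `s` in `End(C)` is the component `T_G` of such a
family, then for every `f : G ⟶ X` the defining property of `ρ^X` and naturality give `ρ^X(s) f = f
s = T_X f`. The ranges of the operators `f` span a dense subspace, so `ρ^X(s) = T_X`. This is
`rho_eq_transport`.

Applied to the actions `π_{FX}(a)`, to natural transformations into `Mod(A)`, to the representations
`ρ^{FX}(a)` and to natural transformations between arbitrary morphisms, the principle yields
`rho_phiObj`, `rho_Phi_map`, `rho_endMap` and `rho_endMap₂`. Together with `ρ^G(a) = a`
(`rho_self`), they show that `Φ` and `Ψ` are mutually inverse, that `End` respects composition and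
whiskering, and that `Φ` is natural in morphisms. For horizontal composites of 2-cells, naturality
of `ξ` and the intertwining property are used as well.

The counit needs a second separating object of `Mod(A)`, the identity representation: it forces
`π_G(ρ^{Id}(a)) = a`, while `ρ^{Id}(π_G(a)) = a` is again an instance of the principle. The analysis
(existence and normality of `ρ^X`, the separating property of the identity representation) is
already contained in the constructions.

What remains is bookkeeping. The equality `U_D F = U_C` holds on the nose but not definitionally, so
operators on `H(FX)` and on `H(X)` are compared by `transport` or by heterogeneous equality. -/

namespace Bicategory.Opposite

/-! ### Strictness of the opposite 2-category. -/

open CategoryTheory.Bicategory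

/-- The 1-cell dual of a strict bicategory is strict. -/
instance {B : Type*} [CategoryTheory.Bicategory B] [Strict B] : Strict Bᵒᵖ where
  leftUnitor_eqToIso f := by
    -- Reversing 1-cells exchanges the two unitors and inverts the associator; the direction of
    -- 2-cells is kept, so `opFunctor` carries `eqToIso` to `eqToIso`.
    change (ρ_ f.unop).op2_unop = _
    rw [Strict.rightUnitor_eqToIso]
    exact eqToIso_map (opFunctor _ _) _
  rightUnitor_eqToIso f := by
    change (λ_ f.unop).op2_unop = _
    rw [Strict.leftUnitor_eqToIso]
    exact eqToIso_map (opFunctor _ _) _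
  associator_eqToIso f g h := by
    change (α_ h.unop g.unop f.unop).op2_unop.symm = _
    rw [Strict.associator_eqToIso]
    exact congrArg Iso.symm (eqToIso_map (opFunctor _ _) _)

end Bicategory.Opposite

namespace VNCat

variable {N : VNAlg.{u}}

/-! ### Transport of operators along equalities of bimodules, and equality of dependent data. -/

section Transport

variable {P P' Q Q' R R' : Bimod N}

theorem transport_heq (h : P = Q) (h' : P' = Q') (T : P.H →L[ℂ] P'.H) :
    HEq (transport h h' T) T := by
  subst h h'; rfl

theorem transport_transport (h : P = Q) (h' : P' = Q') (k : Q = R) (k' : Q' = R')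
    (T : P.H →L[ℂ] P'.H) :
    transport k k' (transport h h' T) = transport (h.trans k) (h'.trans k') T := by
  subst h h' k k'; rfl

/-- This absorbs the different proofs of equality that arise when a composite functor is treated as
one functor or one factor at a time. -/
theorem transport_eq_transport (h : P = R) (h' : P' = R') (k : Q = R) (k' : Q' = R')
    {T : P.H →L[ℂ] P'.H} {S : Q.H →L[ℂ] Q'.H} (e : HEq T S) :
    transport h h' T = transport k k' S :=
  eq_of_heq ((transport_heq _ _ _).trans (e.trans (transport_heq _ _ _).symm))

end Transport

namespace ModObj

variable {A : WObj N}

/-- A representation is its Hilbert space together with `π`; the remaining fields are propositions.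
-/
theorem ext_of_transport {X Y : ModObj A} (h : X.toBimod = Y.toBimod)
    (hπ : ∀ a, transport h h (X.π a) = Y.π a) : X = Y := by
  -- The equality `h` cannot be eliminated directly, as neither side is a variable. The equality of
  -- Hilbert spaces can, once the structures are unpacked.
  have hH : X.H = Y.H := congrArg Bimod.H h
  obtain ⟨H, π, _, _, _⟩ := X
  obtain ⟨H', π', _, _, _⟩ := Y
  dsimp only at hH
  subst hH
  have : π = π' := StarAlgHom.ext fun a => (eq_of_heq (transport_heq h h (π a))).symm.trans (hπ a)
  subst this
  rfl

theorem hom_heq {X X' Y Y' : ModObj A} (hX : X = X') (hY : Y = Y') (T : X ⟶ Y) (T' : X' ⟶ Y')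
    (h : HEq T.opr T'.opr) : HEq T T' := by
  subst hX hY
  exact heq_of_eq (hom_ext (eq_of_heq h))

end ModObj

/-- The type of the underlying element depends only on the target algebra, not on the two morphisms,
so elements can be compared by ordinary equality. -/
theorem WObj.hom₂_heq {A B : WObj N} {φ φ' ψ ψ' : A ⟶ B} (hφ : φ = φ') (hψ : ψ = ψ')
    (b : φ ⟶ ψ) (b' : φ' ⟶ ψ') (h : Hom₂.val b = Hom₂.val b') : HEq b b' := by
  subst hφ hψ
  exact heq_of_eq (hom₂_ext h)

/-- Canonical 2-cells have underlying element `1`. Coherence conditions thus reduce to equations in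
the target algebra; this serves both for `End` and for the naturality of `Φ` in 2-cells. -/
theorem WObj.eq_eqToHom_comp {A B : WObj N} {φ φ' ψ ψ' : A ⟶ B} (hφ : φ = φ') (hψ : ψ' = ψ)
    {b : φ ⟶ ψ} {b' : φ' ⟶ ψ'} (h : Hom₂.val b = Hom₂.val b') :
    b = eqToHom hφ ≫ b' ≫ eqToHom hψ := by
  subst hφ hψ
  rw [eqToHom_refl, eqToHom_refl, Category.id_comp, Category.comp_id]
  exact hom₂_ext h

theorem CatN.hom₂_heq {C D : CatN N} {F F' K K' : C ⟶ D} (hF : F = F') (hK : K = K')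
    (α : F ⟶ K) (β : F' ⟶ K') (h : ∀ X, HEq (α.nt.app X) (β.nt.app X)) : HEq α β := by
  subst hF hK
  exact heq_of_eq (hom₂_ext (NatTrans.ext (funext fun X => eq_of_heq (h X))))

/-! ### Natural families of operators are determined at the separating object. -/

section Rho

variable {C D : CatN N} (G : C.Sep)

/-- For `f : G ⟶ G`, the operator `a` satisfies `a f = f a` because it lies in the commutant; this
is the property that determines `ρ^G(a)`. -/
theorem rho_self (a : (endObj C G).El) : rho G G.obj a = endVal G a :=
  ext_of_sep G fun f ξ => by
    rw [rho_apply]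
    exact (DFunLike.congr_fun ((mem_endAlg C G _).1 a.2 f) ξ).symm

/-- If `s ∈ End(C)` is the component at the separating object of a family of operators that is
natural in `X`, then the components of this family are the operators `ρ^X(s)`. -/
theorem rho_eq_transport {F F' : C ⟶ D}
    (T : ∀ X, (D.U.obj (F.F.obj X)).H →L[ℂ] (D.U.obj (F'.F.obj X)).H)
    (hT : ∀ {X Y} (f : X ⟶ Y), T Y ∘L opOf D.U (F.F.map f) = opOf D.U (F'.F.map f) ∘L T X)
    (s : (endObj C G).El)
    (hs : endVal G s = transport (F.obj_eq G.obj) (F'.obj_eq G.obj) (T G.obj)) (X : C.C) :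
    rho G X s = transport (F.obj_eq X) (F'.obj_eq X) (T X) :=
  ext_of_sep G fun f ξ => by
    rw [rho_apply, hs]
    -- Naturality along `f : G ⟶ X`, moved to the spaces `H(G)` and `H(X)`, where `F(f)` and `F'(f)`
    -- both become the operator of `f`: it reads `T_X f = f T_G`.
    have h := congrArg (transport (F.obj_eq G.obj) (F'.obj_eq X)) (hT f)
    rw [transport_comp _ (F.obj_eq X), transport_comp _ (F'.obj_eq G.obj), F.transport_map,
      F'.transport_map] at h
    exact (DFunLike.congr_fun h ξ).symm

variable {A : WObj N}

/-- The actions of a fixed `a` are natural because morphisms of `Mod(A)` are intertwiners. Here and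
in the next three lemmas, `rfl` identifies `s` with the component at `G`, since `homOf` and `cellOf`
are defined by transporting it. -/
theorem rho_phiObj (F : C ⟶ modObj A) (a : A.El) (X : C.C) :
    rho G X ((phiObj G F).hom a) = transport (F.obj_eq X) (F.obj_eq X) ((F.F.obj X).π a) :=
  rho_eq_transport G (F := F) (F' := F) (fun X => (F.F.obj X).π a)
    (fun f => (ModObj.Hom.comm (F.F.map f) a).symm) _ rfl X

theorem rho_Phi_map {F F' : C ⟶ modObj A} (α : F ⟶ F') (X : C.C) :
    rho G X (WObj.Hom₂.val ((Phi G A).map α)) =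
      transport (F.obj_eq X) (F'.obj_eq X) (ModObj.Hom.opr (α.nt.app X)) :=
  rho_eq_transport G (F := F) (F' := F') (fun X => ModObj.Hom.opr (α.nt.app X))
    (fun f => congrArg ModObj.Hom.opr (α.nt.naturality f)) _ rfl X

/-- Extends the definition of `End(F)`, which concerns only `G_C`, to all objects; functoriality of
`End` uses it at the object `F(G_C)` of the middle category. -/
theorem rho_endMap (G : ∀ C : CatN N, C.Sep) (F : C ⟶ D) (a : (endObj D (G D)).El) (X : C.C) :
    rho (G C) X ((endMap G F).hom a) =
      transport (F.obj_eq X) (F.obj_eq X) (rho (G D) (F.F.obj X) a) :=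
  rho_eq_transport (G C) (F := F) (F' := F) (fun X => rho (G D) (F.F.obj X) a)
    (fun f => (rho_naturality (G D) (F.F.map f) a).symm) _ rfl X

theorem rho_endMap₂ (G : ∀ C : CatN N, C.Sep) {F F' : C ⟶ D} (α : F ⟶ F') (X : C.C) :
    rho (G C) X (WObj.Hom₂.val (endMap₂ G α)) =
      transport (F.obj_eq X) (F'.obj_eq X) (opOf D.U (α.nt.app X)) :=
  rho_eq_transport (G C) (F := F) (F' := F') (fun X => opOf D.U (α.nt.app X))
    (fun f => by
      have h := congrArg (opOf D.U) (α.nt.naturality f)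
      rwa [opOf_comp, opOf_comp] at h) _ rfl X

end Rho

/-! ### `Φ` and `Ψ` are mutually inverse. -/

section Inverse

variable {C : CatN N} (G : C.Sep) {A : WObj N}

/-- On objects, `rho_phiObj` recovers the action on `F(X)` from the one on `F(G)`. On morphisms,
both functors have the underlying operator of `f`, as they lie over bimodules. -/
theorem Psi_obj_phiObj (F : C ⟶ modObj A) : (Psi G A).obj (phiObj G F) = F := by
  have h : ∀ X, ((Psi G A).obj (phiObj G F)).F.obj X = F.F.obj X := fun X =>
    ModObj.ext_of_transport
      -- Both underlying bimodules equal `U_C(X)`, so only the actions of `A` have to be compared.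
      ((CatN.Hom.obj_eq ((Psi G A).obj (phiObj G F)) X).trans (F.obj_eq X).symm) fun a => by
        have h := (heq_of_eq (rho_phiObj G F a X)).trans (transport_heq _ _ _)
        exact eq_of_heq ((transport_heq _ _ _).trans h)
  refine CatN.Hom.ext (CategoryTheory.Functor.hext h fun X Y f =>
    ModObj.hom_heq (h X) (h Y) _ _ ?_)
  have h := F.transport_map f
  exact (heq_of_eq h.symm).trans (transport_heq _ _ _)

theorem phiObj_Psi_obj (π : A ⟶ endObj C G) : phiObj G ((Psi G A).obj π) = π := by
  refine WObj.Hom.ext (StarAlgHom.ext fun a => Subtype.ext ?_)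
  refine Eq.trans ?_ (rho_self G (π.hom a))
  exact eq_of_heq (transport_heq
    (CatN.Hom.obj_eq ((Psi G A).obj π) G.obj) (CatN.Hom.obj_eq ((Psi G A).obj π) G.obj) _)

/-- On 2-cells this is `ρ^X(α_G) = α_X`: a natural transformation is recovered from its component at
the separating object. -/
theorem Phi_comp_Psi : Phi G A ⋙ Psi G A = 𝟭 _ :=
  CategoryTheory.Functor.hext (Psi_obj_phiObj G) fun F F' α =>
    CatN.hom₂_heq (Psi_obj_phiObj G F) (Psi_obj_phiObj G F') _ _ fun X =>
      ModObj.hom_heq (congrArg (fun K : C ⟶ modObj A => K.F.obj X) (Psi_obj_phiObj G F))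
        (congrArg (fun K : C ⟶ modObj A => K.F.obj X) (Psi_obj_phiObj G F')) _ _
        ((heq_of_eq (rho_Phi_map G α X)).trans (transport_heq _ _ _))

theorem Psi_comp_Phi : Psi G A ⋙ Phi G A = 𝟭 _ :=
  CategoryTheory.Functor.hext (phiObj_Psi_obj G) fun π π' S =>
    WObj.hom₂_heq (phiObj_Psi_obj G π) (phiObj_Psi_obj G π') _ _ (Subtype.ext (by
      refine Eq.trans ?_ (rho_self G (WObj.Hom₂.val S))
      exact eq_of_heq (transport_heq (CatN.Hom.obj_eq ((Psi G A).obj π) G.obj)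
        (CatN.Hom.obj_eq ((Psi G A).obj π') G.obj) _)))

end Inverse

/-! ### `Mod` and `End` are contravariant strict 2-functors. -/

section TwoFunctor

theorem modData_isTwoFunctor (N : VNAlg.{u}) : IsTwoFunctor (modData N) :=
  ⟨StrictPseudofunctor.mk''
    { toPrelaxFunctorStruct := modData N
      map₂_id := fun _ => CatN.hom₂_ext (NatTrans.ext (funext fun X =>
        ModObj.hom_ext (map_one (ModObj.π X))))
      map₂_comp := fun _ _ => CatN.hom₂_ext (NatTrans.ext (funext fun X =>
        ModObj.hom_ext (map_mul (ModObj.π X) _ _)))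
      map_id := fun _ => rfl
      map_comp := fun _ _ => rfl
      -- Composition is preserved definitionally, so the canonical 2-cells around the whiskered one
      -- are identities and only have to be cancelled.
      map₂_whisker_left := fun _ _ _ _ =>
        ((Category.id_comp _).trans (Category.comp_id _)).symm
      map₂_whisker_right := fun _ _ =>
        ((Category.id_comp _).trans (Category.comp_id _)).symm }, rfl⟩

variable {C D E : CatN N} (G : ∀ C : CatN N, C.Sep)

theorem endMap_id (C : CatN N) : endMap G (𝟙 C) = 𝟙 (endObj C (G C)) :=
  WObj.Hom.ext (StarAlgHom.ext fun a => Subtype.ext (rho_self (G C) a))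

/-- Applying `End(F)` to `End(K)(a)` means evaluating `ρ^{F(G_C)}` on it, and by `rho_endMap` this
is `ρ^{K(F(G_C))}(a)`. -/
theorem endMap_comp (F : C ⟶ D) (K : D ⟶ E) : endMap G (F ≫ K) = endMap G K ≫ endMap G F := by
  refine WObj.Hom.ext (StarAlgHom.ext fun a => Subtype.ext ?_)
  have h := congrArg (transport (F.obj_eq (G C).obj) (F.obj_eq (G C).obj))
    (rho_endMap G K a (F.F.obj (G C).obj))
  rw [transport_transport] at h
  exact h.symm

theorem endMap₂_id (F : C ⟶ D) : endMap₂ G (𝟙 F) = 𝟙 (endMap G F) := by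
  refine WObj.hom₂_ext (Subtype.ext ?_)
  change transport (F.obj_eq _) (F.obj_eq _) (opOf D.U (𝟙 _)) = _
  rw [opOf_id]
  exact transport_id _

theorem endMap₂_comp {F F' F'' : C ⟶ D} (α : F ⟶ F') (β : F' ⟶ F'') :
    endMap₂ G (α ≫ β) = endMap₂ G α ≫ endMap₂ G β := by
  refine WObj.hom₂_ext (Subtype.ext ?_)
  change transport (F.obj_eq _) (F''.obj_eq _) (opOf D.U (α.nt.app _ ≫ β.nt.app _)) = _
  rw [opOf_comp]
  exact transport_comp _ (F'.obj_eq _) _ _ _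

/-- The component of `β` at `F(G_C)`, rather than at `G_D`, is obtained by applying `ρ^{F(G_C)}` to
the component at `G_D`. -/
theorem endMap₂_whiskerL_val (F : C ⟶ D) {K K' : D ⟶ E} (β : K ⟶ K') :
    WObj.Hom₂.val (endMap₂ G (CatN.whiskerL F β)) =
      (endMap G F).hom (WObj.Hom₂.val (endMap₂ G β)) := by
  refine Subtype.ext ?_
  have h := congrArg (transport (F.obj_eq (G C).obj) (F.obj_eq (G C).obj))
    (rho_endMap₂ G β (F.F.obj (G C).obj))
  rw [transport_transport] at h
  exact h.symm

/-- `K` lies over bimodules, hence `K(α_G)` and `α_G` have the same underlying operator. -/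
theorem endMap₂_whiskerR_val {F F' : C ⟶ D} (α : F ⟶ F') (K : D ⟶ E) :
    WObj.Hom₂.val (endMap₂ G (CatN.whiskerR α K)) = WObj.Hom₂.val (endMap₂ G α) := by
  refine Subtype.ext ?_
  have h := congrArg (transport (F.obj_eq (G C).obj) (F'.obj_eq (G C).obj))
    (K.transport_map (α.nt.app (G C).obj))
  rw [transport_transport] at h
  exact h

theorem endData_isTwoFunctor : IsTwoFunctor (endData G) :=
  ⟨StrictPseudofunctor.mk''
    { toPrelaxFunctorStruct := endData G
      map₂_id := fun F => endMap₂_id G F.unop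
      map₂_comp := fun α β => endMap₂_comp G α.unop2 β.unop2
      map_id := fun C => endMap_id G C.unop
      map_comp := fun F K => endMap_comp G K.unop F.unop
      -- Left whiskering in the opposite 2-category is right whiskering in the original one, and
      -- conversely.
      map₂_whisker_left := fun F _ _ α =>
        WObj.eq_eqToHom_comp _ _ (endMap₂_whiskerR_val G α.unop2 F.unop)
      map₂_whisker_right := fun α K =>
        WObj.eq_eqToHom_comp _ _ (endMap₂_whiskerL_val G K.unop α.unop2) }, rfl⟩

end TwoFunctor

/-! ### Naturality of `Φ`, the counit and the triangle identities. -/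

section Adjunction

open Bicategory
open _root_.Bicategory.Opposite (op2)

variable {C D : CatN N} {A B : WObj N} (G : ∀ C : CatN N, C.Sep)

/-- Both sides send `a` to the action of `φ(a)` on `X(F(G_C))`: for the right side this is
`rho_phiObj` for `X` at the object `F(G_C)`. -/
theorem phiObj_comp (F : C ⟶ D) (X : D ⟶ modObj B) (φ : A ⟶ B) :
    phiObj (G C) (F ≫ X ≫ modMap φ) = φ ≫ phiObj (G D) X ≫ endMap G F := by
  refine WObj.Hom.ext (StarAlgHom.ext fun a => Subtype.ext ?_)
  have hF := F.obj_eq (G C).obj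
  have hX := X.obj_eq (F.F.obj (G C).obj)
  have h := congrArg (transport hF hF) (rho_phiObj (G D) X (φ.hom a) (F.F.obj (G C).obj))
  have h' := transport_transport hX hX hF hF ((X.F.obj (F.F.obj (G C).obj)).π (φ.hom a))
  refine Eq.trans ?_ (h.trans h').symm
  exact transport_eq_transport (CatN.Hom.obj_eq (F ≫ X ≫ modMap φ) _)
    (CatN.Hom.obj_eq (F ≫ X ≫ modMap φ) _) _ _ HEq.rfl

/-- With `c = G_C` and `b` the element of `β`, the left side is `π(b) ξ_{F'c} X(α_c)` and the right
side is `X'(α_c) ξ_{Fc} π(b)`, up to transport. The factors occur in opposite orders because `Φ`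
exchanges the order of composition. -/
theorem Phi_map_comp_val {F F' : C ⟶ D} (α : F ⟶ F') {X X' : D ⟶ modObj B} (ξ : X ⟶ X')
    {φ φ' : A ⟶ B} (β : φ ⟶ φ') :
    WObj.Hom₂.val ((Phi (G C) A).map
      (α ▷ (X ≫ modMap φ) ≫ F' ◁ (ξ ▷ modMap φ ≫ X' ◁ modMap₂ β))) =
      WObj.Hom₂.val (β ▷ (phiObj (G D) X ≫ endMap G F) ≫
        φ' ◁ ((Phi (G D) B).map ξ ▷ endMap G F ≫ phiObj (G D) X' ◁ endMap₂ G α)) := by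
  refine Subtype.ext ?_
  set c := (G C).obj
  have hF := F.obj_eq c
  have hF' := F'.obj_eq c
  have hX := X.obj_eq (F.F.obj c)
  have hX' := X'.obj_eq (F.F.obj c)
  have hX'' := X'.obj_eq (F'.F.obj c)
  let b := WObj.Hom₂.val β
  let T := ModObj.Hom.opr (X'.F.map (α.nt.app c))
  let S := ModObj.Hom.opr (ξ.nt.app (F.F.obj c))
  -- Naturality of `ξ` at `α_c` exchanges the two right factors; then `b` passes through, as the
  -- resulting composite is an intertwiner.
  have e : ((X'.F.obj (F'.F.obj c)).π b ∘L ModObj.Hom.opr (ξ.nt.app (F'.F.obj c))) ∘L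
      ModObj.Hom.opr (X.F.map (α.nt.app c)) = (T ∘L S) ∘L (X.F.obj (F.F.obj c)).π b := by
    have h1 := congrArg ModObj.Hom.opr (ξ.nt.naturality (α.nt.app c))
    have h2 := ModObj.Hom.comm (ξ.nt.app (F.F.obj c) ≫ X'.F.map (α.nt.app c)) b
    exact (congrArg ((X'.F.obj (F'.F.obj c)).π b ∘L ·) h1).trans h2.symm
  -- The three factors `T`, `S`, `π(b)` are identified with the elements of `End(C)` in the
  -- right-hand 2-cell. Each passes through `H(F(c))` or `H(F'(c))`, where the facts about `D`
  -- apply.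
  have eα : transport (hX'.trans hF) (hX''.trans hF') T =
      endVal (G C) (WObj.Hom₂.val (endMap₂ G α)) := by
    refine (transport_transport hX' hX'' hF hF' T).symm.trans ?_
    exact congrArg (transport hF hF') (X'.transport_map (α.nt.app c))
  have eξ : transport (hX.trans hF) (hX'.trans hF) S =
      endVal (G C) ((endMap G F).hom (WObj.Hom₂.val ((Phi (G D) B).map ξ))) := by
    refine (transport_transport hX hX' hF hF S).symm.trans ?_
    exact congrArg (transport hF hF) (rho_Phi_map (G D) ξ (F.F.obj c)).symm
  have eβ : transport (hX.trans hF) (hX.trans hF) ((X.F.obj (F.F.obj c)).π b) =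
      endVal (G C) ((endMap G F).hom ((phiObj (G D) X).hom b)) := by
    refine (transport_transport hX hX hF hF _).symm.trans ?_
    exact congrArg (transport hF hF) (rho_phiObj (G D) X b (F.F.obj c)).symm
  have h := transport_comp (hX.trans hF) (hX.trans hF) (hX''.trans hF') (T ∘L S)
    ((X.F.obj (F.F.obj c)).π b)
  have h' := transport_comp (hX.trans hF) (hX'.trans hF) (hX''.trans hF') T S
  have hα := congrArg₂ ContinuousLinearMap.comp eα eξ
  have hβ := congrArg₂ ContinuousLinearMap.comp (h'.trans hα) eβ
  refine Eq.trans ?_ (h.trans hβ)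
  exact transport_eq_transport (CatN.Hom.obj_eq (F ≫ X ≫ modMap φ) c)
    (CatN.Hom.obj_eq (F' ≫ X' ≫ modMap φ') c) _ _ (heq_of_eq e)

/-- The identity representation is separating too, so `π_G(ε(a)) = a` may be tested on the ranges of
intertwiners `f` from it to `G`. There `π_G(ε(a)) f = f ε(a)`, and `f ε(a) = a f` by naturality of
`ρ` and `rho_self`. -/
theorem epsilon_comp_phiObj (A : WObj N) (G : (modObj A).Sep) :
    epsilon A G ≫ phiObj G (𝟙 (modObj A)) = 𝟙 _ := by
  refine WObj.Hom.ext (StarAlgHom.ext fun a => Subtype.ext ?_)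
  change G.obj.π (epsilon A G |>.hom a) = endVal G a
  refine ext_of_dense (ModObj.idRep_separating A G.obj) ?_
  rintro _ ⟨f, rfl⟩ ξ
  have h := rho_naturality G f a
  rw [rho_self] at h
  have h' := ModObj.Hom.comm f ((epsilon A G).hom a)
  exact (DFunLike.congr_fun h' ξ).symm.trans (DFunLike.congr_fun h ξ)

theorem phiObj_comp_epsilon (A : WObj N) (G : (modObj A).Sep) :
    phiObj G (𝟙 (modObj A)) ≫ epsilon A G = 𝟙 _ :=
  WObj.Hom.ext (StarAlgHom.ext fun a =>
    Subtype.ext (rho_phiObj G (𝟙 (modObj A)) a (ModObj.idRep A)))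

/-- By `rho_phiObj` for the identity functor, `End(η)` maps the image of `a` to the action of `a` on
`η(G_C)`, which is `ρ^{G_C}(a) = a`. -/
theorem phiObj_comp_endMap_eta (C : CatN N) :
    phiObj (G (modObj (endObj C (G C)))) (𝟙 _) ≫ endMap G (eta C (G C)) = 𝟙 _ := by
  refine WObj.Hom.ext (StarAlgHom.ext fun a => Subtype.ext ?_)
  have h := rho_phiObj (G (modObj (endObj C (G C)))) (𝟙 _) a (etaObj (G C) (G C).obj)
  refine Eq.trans ?_ (rho_self (G C) a)
  exact (eq_of_heq (transport_heq ((eta C (G C)).obj_eq (G C).obj) ((eta C (G C)).obj_eq (G C).obj)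
    (rho (G (modObj (endObj C (G C)))) (etaObj (G C) (G C).obj) _))).trans h

theorem isAdjunction_Mod_End :
    IsAdjunction (modData N) (endData G) (fun C A => Phi (G C) A) (fun C A => Psi (G C) A)
      (fun C => eta C (G C)) (fun A => epsilon A (G (modObj A))) where
  left_inv C _ := Phi_comp_Psi (G C)
  right_inv C _ := Psi_comp_Phi (G C)
  nat_obj F X φ := phiObj_comp G F X φ
  nat_map α _ _ ξ _ _ β := WObj.eq_eqToHom_comp _ _ (Phi_map_comp_val G α ξ β)
  -- Restriction along the identity is definitionally trivial, so `η` is `Ψ` of the identity.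
  -- Likewise, the left side of the first triangle identity is `Ψ(Φ(id))`.
  unit C := phiObj_Psi_obj (G C) (𝟙 _)
  counit_left A := epsilon_comp_phiObj A _
  counit_right A := phiObj_comp_epsilon A _
  triangle_left A := Psi_obj_phiObj (G (modObj A)) (𝟙 (modObj A))
  triangle_right C := phiObj_comp_endMap_eta G C

end Adjunction

end VNCat

theorem theorem4p13 (N : VNCat.VNAlg.{u}) (G : ∀ C : VNCat.CatN N, C.Sep) :
    VNCat.IsTwoFunctor (VNCat.modData N) ∧
      VNCat.IsTwoFunctor (VNCat.endData G) ∧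
      VNCat.IsAdjunction (VNCat.modData N) (VNCat.endData G)
        (fun C A => VNCat.Phi (G C) A) (fun C A => VNCat.Psi (G C) A)
        (fun C => VNCat.eta C (G C)) (fun A => VNCat.epsilon A (G (VNCat.modObj A))) :=
  ⟨VNCat.modData_isTwoFunctor N, VNCat.endData_isTwoFunctor G, VNCat.isAdjunction_Mod_End G⟩
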